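/- For a vector $v$ put $\|v\|_1=\sum_i|v_i|$, and for a matrix $M$ put $\|M\|_1=\sum_{i,j}|M_{ij}|$. A matrix $U$ with $n$ rows is a basis of $A\in\mathbb{R}^{n\times d}$ if its columns form a basis of the column space of $A$; it is $(d,1,1)$-well-conditioned if $\|U\|_1\le d$ and $\|x\|_\infty\le\|Ux\|_1$ for all $x$. A distribution over $r\times n$ matrices $S$ is an $\ell_1$ oblivious subspace embedding with distortion $\kappa$ if for every fixed $A\in\mathbb{R}^{n\times d}$, with probability at least $0.99$, $\|Ax\|_1\le\|SAx\|_1\le\kappa\|Ax\|_1$ for all $x\in\mathbb{R}^d$. A CountSketch with $R$ rows is a random $R\times n$ matrix in which each column independently has a single non-zero entry, in a uniformly random row and with a uniformly random value in $\{-1,1\}$. A sparse Cauchy sketch with $R$ rows is defined in the same way, except that the non-zero values are i.i.d. standard Cauchy random variables, independent of the positions. **Theorem.** There are absolute constants $c,C,K>0$ such that for every integer $d\ge 2$ there are $R_1,R_2\in\mathbb{N}$ with $R_1+R_2\le K d^2$ such that the following holds for every $n$. Let $\Pi=\begin{pmatrix}\Pi_1\\ \Pi_2\end{pmatrix}$,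 where $\Pi_1$ is $d\log d$ times a CountSketch with $R_1$ rows and $n$ columns, and $\Pi_2$ is an independent sparse Cauchy sketch with $R_2$ rows and $n$ columns. Then: 1. Almost surely, every column of $\Pi$ has exactly two non-zero entries. 2. For every $A\in\mathbb{R}^{n\times d}$ and every $(d,1,1)$-well-conditioned basis $U$ of $A$, with probability at least $0.99$, for all $x$, $$c\log d\,\|Ux\|_1\le\|\Pi Ux\|_1\le C\,d\log d\,\|Ux\|_1 .$$ 3. The rescaled matrix $(c\log d)^{-1}\,\Pi$ is an $\ell_1$ oblivious subspace embedding with distortion $(C/c)\,d=O(d)$. -/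

import Mathlib

open MeasureTheory ProbabilityTheory

noncomputable section

namespace SparseEmbedding

/-- The `ℓ₁`-norm of a vector. -/
def l1Norm {ι : Type*} [Fintype ι] (v : ι → ℝ) : ℝ := ∑ i, |v i|

/-- The entrywise `ℓ₁`-norm of a matrix. -/
def entryL1Norm {m k : Type*} [Fintype m] [Fintype k] (M : Matrix m k ℝ) : ℝ :=
  ∑ i, ∑ j, |M i j|

/-- Real matrices carry the product σ-algebra of their entries. -/
instance instMeasurableSpaceRealMatrix {m k : Type*} : MeasurableSpace (Matrix m k ℝ) :=
  inferInstanceAs (MeasurableSpace (m → k → ℝ))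

/-- `U` is a basis matrix of `A`: its columns are a basis of the column space of `A`. -/
def IsBasisMatrix {n d k : ℕ} (U : Matrix (Fin n) (Fin k) ℝ) (A : Matrix (Fin n) (Fin d) ℝ) :
    Prop :=
  LinearIndependent ℝ U.col ∧
    Submodule.span ℝ (Set.range U.col) = Submodule.span ℝ (Set.range A.col)

/-- `U` is `(α, β, 1)`-well-conditioned: `‖U‖₁ ≤ α`, and `‖x‖_∞ ≤ β ‖Ux‖₁` for every `x`
(the norm of `Fin k → ℝ` is the sup norm). -/
def IsWellConditioned {n k : ℕ} (α β : ℝ) (U : Matrix (Fin n) (Fin k) ℝ) : Prop :=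
  entryL1Norm U ≤ α ∧ ∀ x : Fin k → ℝ, ‖x‖ ≤ β * l1Norm (U.mulVec x)

/-- A distribution `μ` over matrices with `n` columns is an `ℓ₁` oblivious subspace embedding
for `n × d` matrices, with distortion `κ`. -/
def IsL1ObliviousSubspaceEmbedding {r : Type*} [Fintype r] {n : ℕ} (d : ℕ) (κ : ℝ)
    (μ : Measure (Matrix r (Fin n) ℝ)) : Prop :=
  IsProbabilityMeasure μ ∧
    ∀ A : Matrix (Fin n) (Fin d) ℝ,
      0.99 ≤ μ.real {S | ∀ x : Fin d → ℝ,
        l1Norm (A.mulVec x) ≤ l1Norm (S.mulVec (A.mulVec x)) ∧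
          l1Norm (S.mulVec (A.mulVec x)) ≤ κ * l1Norm (A.mulVec x)}

/-- The `R × n` binary matrix `Φ` with `Φ (h i) i = 1` and all other entries `0`. -/
def hashMatrix {R n : ℕ} (h : Fin n → Fin R) : Matrix (Fin R) (Fin n) ℝ :=
  Matrix.of fun t i => if h i = t then 1 else 0

/-- The distribution of `Φ D`, where `Φ` is the binary matrix of a uniformly random map
`h : [n] → [R]`, and `D` is an independent diagonal matrix with i.i.d. diagonal entries of
law `ν`. -/
def hashSketchLaw (ν : Measure ℝ) (R n : ℕ) : Measure (Matrix (Fin R) (Fin n) ℝ) :=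
  ((Measure.pi fun _ : Fin n => uniformOn (Set.univ : Set (Fin R))).prod
    (Measure.pi fun _ : Fin n => ν)).map
      fun ω => hashMatrix ω.1 * Matrix.diagonal ω.2

/-- The CountSketch distribution with `R` rows: each column has a single nonzero entry, in a
uniformly random row and with a uniformly random sign. -/
def countSketchLaw (R n : ℕ) : Measure (Matrix (Fin R) (Fin n) ℝ) :=
  hashSketchLaw (uniformOn ({1, -1} : Set ℝ)) R n

/-- The sparse Cauchy sketch with `R` rows: each column has a single nonzero entry, in a
uniformly random row and with a standard Cauchy value. -/
def sparseCauchyLaw (R n : ℕ) : Measure (Matrix (Fin R) (Fin n) ℝ) :=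
  hashSketchLaw (cauchyMeasure 0 1) R n

/-- The distribution of `Π = (Π₁; Π₂)`, where `Π₁` is a CountSketch with `R₁` rows scaled by the
factor `s`, stacked on top of an independent sparse Cauchy sketch `Π₂` with `R₂` rows. -/
def stackedSketchLaw (s : ℝ) (R₁ R₂ n : ℕ) : Measure (Matrix (Fin R₁ ⊕ Fin R₂) (Fin n) ℝ) :=
  ((countSketchLaw R₁ n).prod (sparseCauchyLaw R₂ n)).map
    fun S => Matrix.fromRows (s • S.1) S.2

end SparseEmbedding

end

/-!
# A sparse `ℓ₁` oblivious subspace embedding with two non-zero entries per column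

Let `y = U x` with `‖y‖₁ = 1`, where `U` is `(d, 1, 1)`-well-conditioned, so that `‖x‖_∞ ≤ 1`. The
embedding has two parts of dimension `Θ(d²)`, and each of them handles one kind of vector.

*Vectors with large Euclidean norm.* A CountSketch `S` with `Ω(d²)` rows preserves the Euclidean norm
on a fixed `d`-dimensional subspace up to a factor `2`: for an orthonormal basis matrix `Q` of the
subspace, the second moment of the Frobenius norm of `QᵀSᵀSQ - I` is `O(d² / R)`
(`integral_collisionForm_sq_le`, `countSketch_lower`). Hence `‖S y‖₁ ≥ ‖S y‖₂ ≥ ‖y‖₂ / 2`, and after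
scaling by `d log d` this is `Ω(log d)` as soon as `‖y‖₂ = Ω(1 / d)`.

*Flat vectors.* If `‖y‖₂` is smaller, most of the `ℓ₁`-mass of `y` lies on entries of size
`O(1 / d²)`. For a fixed `y` of this kind, the sparse Cauchy sketch has `ℓ₁`-norm `Ω(log d)` except
with probability `exp (-Ω(d log d))` (`cauchySketch_lower`). The proof bounds the Laplace transform of
the norm. As `e^{-|x|}` is the characteristic function of the Cauchy law (`charFun_cauchyMeasure`,
obtained by Fourier inversion), the Laplace transform of `‖M c‖₁` for a Cauchy vector `c` equals that
of `‖Mᵀ z‖₁` for a Cauchy vector `z` (`integral_exp_neg_sum_abs_swap`). For a hashing matrix, `Mᵀ z`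
has the entries `y i * z (h i)`, and these are independent given `z`, so that averaging over the hash
function `h` gives a product (`prod_average_exp_le`). What remains is the average of `min |z r| d`
over the `Θ(d²)` rows, whose mean is of order `log d` (`truncMean`) and which concentrates because its
terms are bounded.

*From one vector to all.* With high probability the images of the columns of `U` under the sparse
Cauchy sketch have total `ℓ₁`-norm `O(d log d)` (`cauchySketch_upper`: stability of the Cauchy law,
truncation, and Markov's inequality). As `‖x‖_∞ ≤ ‖U x‖₁`, this gives the upper bound, and it also
makes the lower bound stable under perturbations of `x` of size `Θ(1 / d)`, so a union bound over a
grid with `d ^ O(d)` points suffices (`cauchy_grid_prob`, `lower_of_unit`). As `d ≥ 2`, numerical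
constants are absorbed into powers of `d`.

The statement for arbitrary `A` follows since every subspace has a well-conditioned basis, namely an
Auerbach basis for the `ℓ₁`-norm (`exists_auerbach_basis`).
-/

noncomputable section

namespace SparseEmbedding

open Real Set FourierTransform

/-! ### The standard Cauchy distribution -/

lemma integral_cauchyMeasure {E : Type*} [NormedAddCommGroup E] [NormedSpace ℝ E] (f : ℝ → E) :
    ∫ x, f x ∂(cauchyMeasure 0 1) = ∫ x, (π⁻¹ * (1 + x ^ 2)⁻¹) • f x := by
  rw [cauchyMeasure_of_scale_ne_zero 0 one_ne_zero]
  have : cauchyPDF 0 1 = fun x => ENNReal.ofReal (cauchyPDFReal 0 1 x) := rfl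
  rw [this, integral_withDensity_eq_integral_toReal_smul (by fun_prop) (by simp)]
  refine integral_congr_ae (Filter.Eventually.of_forall fun x => ?_)
  simp only
  rw [ENNReal.toReal_ofReal (cauchyPDF_pos 0 one_ne_zero x).le, cauchyPDFReal_def]
  simp [add_comm]

lemma integral_comp_abs_cauchyMeasure (g : ℝ → ℝ) :
    ∫ x, g |x| ∂(cauchyMeasure 0 1) = 2 * (π⁻¹ * ∫ x in Ioi 0, (1 + x ^ 2)⁻¹ * g x) := by
  rw [integral_cauchyMeasure, ← integral_const_mul,
    ← integral_comp_abs (f := fun x => π⁻¹ * ((1 + x ^ 2)⁻¹ * g x))]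
  simp [mul_assoc]

lemma integrable_and_integral_cexp_mul_exp_neg_abs (a : ℝ) :
    Integrable (fun x : ℝ => Complex.exp (a * x * Complex.I) * (rexp (-|x|) : ℂ)) ∧
    ∫ x : ℝ, Complex.exp (a * x * Complex.I) * (rexp (-|x|) : ℂ)
      = ((2 * (1 + a ^ 2)⁻¹ : ℝ) : ℂ) := by
  have hpos : ∀ x ∈ Ioi (0 : ℝ), Complex.exp (a * x * Complex.I) * (rexp (-|x|) : ℂ)
      = Complex.exp ((-1 + a * Complex.I) * x) := by
    intro x hx
    rw [abs_of_pos hx, Complex.ofReal_exp, ← Complex.exp_add]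
    congr 1; push_cast; ring
  have hneg : ∀ x ∈ Iic (0 : ℝ), Complex.exp (a * x * Complex.I) * (rexp (-|x|) : ℂ)
      = Complex.exp ((1 + a * Complex.I) * x) := by
    intro x hx
    rw [abs_of_nonpos hx, Complex.ofReal_exp, ← Complex.exp_add]
    congr 1; push_cast; ring
  have i1 : IntegrableOn (fun x : ℝ => Complex.exp (a * x * Complex.I) * (rexp (-|x|) : ℂ))
      (Ioi 0) :=
    (integrableOn_congr_fun hpos measurableSet_Ioi).2 (integrableOn_exp_mul_complex_Ioi (by simp) 0)
  have i2 : IntegrableOn (fun x : ℝ => Complex.exp (a * x * Complex.I) * (rexp (-|x|) : ℂ))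
      (Iic 0) :=
    (integrableOn_congr_fun hneg measurableSet_Iic).2 (integrableOn_exp_mul_complex_Iic (by simp) 0)
  refine ⟨by rw [← integrableOn_univ, ← Iic_union_Ioi (a := (0 : ℝ))]; exact i2.union i1, ?_⟩
  rw [← intervalIntegral.integral_Iic_add_Ioi i2 i1, setIntegral_congr_fun measurableSet_Iic hneg,
    setIntegral_congr_fun measurableSet_Ioi hpos, integral_exp_mul_complex_Iic (by simp),
    integral_exp_mul_complex_Ioi (by simp)]
  have h1 : (1 + a * Complex.I : ℂ) ≠ 0 := fun h => by simpa using congrArg Complex.re h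
  have h2 : (-1 + a * Complex.I : ℂ) ≠ 0 := fun h => by simpa using congrArg Complex.re h
  have h3 : (1 + (a : ℂ) ^ 2) ≠ 0 := by
    have : (1 + a ^ 2 : ℝ) ≠ 0 := by positivity
    exact_mod_cast this
  push_cast
  simp only [mul_zero, Complex.exp_zero]
  field_simp
  linear_combination (-2 * (a:ℂ)^2) * Complex.I_sq

/-- The characteristic function of the standard Cauchy law. Fourier inversion reduces it to the
elementary Fourier transform of `x ↦ e^{-|x|}`. -/
lemma charFun_cauchyMeasure (t : ℝ) : charFun (cauchyMeasure 0 1) t = (rexp (-|t|) : ℂ) := by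
  let f : ℝ → ℂ := fun x => (rexp (-|x|) : ℂ)
  have hF : 𝓕 f = fun w => ((2 * (1 + (2 * π * w) ^ 2)⁻¹ : ℝ) : ℂ) := by
    ext w
    rw [Real.fourier_real_eq_integral_exp_smul]
    have := (integrable_and_integral_cexp_mul_exp_neg_abs (-2 * π * w)).2
    rw [show (-2 * π * w) ^ 2 = (2 * π * w) ^ 2 by ring] at this
    rw [← this]
    congr 1; ext x
    simp only [smul_eq_mul, f]
    congr 2; push_cast; ring
  have hint : Integrable f := by simpa [f] using (integrable_and_integral_cexp_mul_exp_neg_abs 0).1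
  have hFint : Integrable (𝓕 f) := by
    rw [hF]
    exact ((integrable_inv_one_add_sq.comp_mul_left' (R := 2 * π) (by positivity)).const_mul 2).ofReal
  have hinv := congrFun (Continuous.fourierInv_fourier_eq (by fun_prop) hint hFint) t
  rw [hF, Real.fourierInv_eq'] at hinv
  change _ = f t
  rw [← hinv, charFun_apply_real, integral_cauchyMeasure]
  have := Measure.integral_comp_mul_left (fun x : ℝ =>
    ((2 * (1 + x ^ 2)⁻¹ : ℝ) : ℂ) * Complex.exp (t * x * Complex.I)) (2 * π)
  have e : ∀ v : ℝ, Complex.exp (((2 * π * inner ℝ v t : ℝ) : ℂ) * Complex.I) •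
      ((2 * (1 + (2 * π * v) ^ 2)⁻¹ : ℝ) : ℂ)
      = ((2 * (1 + (2 * π * v) ^ 2)⁻¹ : ℝ) : ℂ) *
        Complex.exp (t * ((2 * π * v : ℝ) : ℂ) * Complex.I) := by
    intro v
    rw [smul_eq_mul, mul_comm]
    congr 2
    simp; ring
  simp_rw [e]
  rw [this, abs_of_pos (by positivity), ← integral_smul]
  congr 1; ext x
  rw [Complex.real_smul, Complex.real_smul]
  push_cast
  have : (π : ℂ) ≠ 0 := by exact_mod_cast pi_ne_zero
  field_simp

lemma integral_cexp_sum_mul_pi_cauchyMeasure {ι : Type*} [Fintype ι] (a : ι → ℝ) :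
    ∫ c, Complex.exp (((∑ i, c i * a i : ℝ) : ℂ) * Complex.I)
      ∂(Measure.pi fun _ : ι => cauchyMeasure 0 1) = (rexp (-∑ i, |a i|) : ℂ) := by
  have : ∀ c : ι → ℝ, Complex.exp (((∑ i, c i * a i : ℝ) : ℂ) * Complex.I)
      = ∏ i, Complex.exp ((a i : ℂ) * (c i : ℂ) * Complex.I) := by
    intro c
    rw [← Complex.exp_sum]
    congr 1
    push_cast
    rw [Finset.sum_mul]
    exact Finset.sum_congr rfl fun i _ => by ring
  simp_rw [this]
  rw [integral_fintype_prod_eq_prod (μ := fun _ : ι => cauchyMeasure 0 1)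
    (fun i (x : ℝ) => Complex.exp ((a i : ℂ) * (x : ℂ) * Complex.I))]
  simp_rw [← charFun_apply_real, charFun_cauchyMeasure]
  rw [← Complex.ofReal_prod, ← Real.exp_sum, Finset.sum_neg_distrib]

/-- Stability of the Cauchy law: a linear combination of independent standard Cauchy variables is
a standard Cauchy variable scaled by the `ℓ₁`-norm of the coefficients. -/
lemma map_sum_mul_pi_cauchyMeasure {ι : Type*} [Fintype ι] (a : ι → ℝ) :
    (Measure.pi fun _ : ι => cauchyMeasure 0 1).map (fun c => ∑ i, c i * a i)
      = (cauchyMeasure 0 1).map (fun z => (∑ i, |a i|) * z) := by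
  have : IsProbabilityMeasure ((Measure.pi fun _ : ι => cauchyMeasure 0 1).map
      (fun c => ∑ i, c i * a i)) :=
    Measure.isProbabilityMeasure_map (Measurable.aemeasurable (by fun_prop))
  have : IsProbabilityMeasure ((cauchyMeasure 0 1).map (fun z => (∑ i, |a i|) * z)) :=
    Measure.isProbabilityMeasure_map (by fun_prop)
  refine Measure.ext_of_charFun (funext fun t => ?_)
  rw [charFun_map_mul, charFun_cauchyMeasure, charFun_apply_real,
    integral_map (Measurable.aemeasurable (by fun_prop)) (by fun_prop)]
  have := integral_cexp_sum_mul_pi_cauchyMeasure fun i => t * a i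
  simp_rw [abs_mul, ← Finset.mul_sum] at this
  rw [abs_mul, abs_of_nonneg (Finset.sum_nonneg fun i _ => abs_nonneg _), mul_comm _ |t|, ← this]
  congr 1; ext c
  congr 2
  push_cast
  rw [Finset.mul_sum]
  exact Finset.sum_congr rfl fun i _ => by ring

/-- Since `e^{-|x|}` is the characteristic function of the Cauchy law, the Laplace transform of
`‖a c‖₁` for a Cauchy vector `c` equals that of `‖aᵀ z‖₁` for a Cauchy vector `z`. -/
lemma integral_exp_neg_sum_abs_swap {ι κ : Type*} [Fintype ι] [Fintype κ] (a : κ → ι → ℝ) :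
    ∫ c, rexp (-∑ t, |∑ i, c i * a t i|) ∂(Measure.pi fun _ : ι => cauchyMeasure 0 1)
      = ∫ z, rexp (-∑ i, |∑ t, z t * a t i|) ∂(Measure.pi fun _ : κ => cauchyMeasure 0 1) := by
  rw [← Complex.ofReal_inj, ← integral_complex_ofReal, ← integral_complex_ofReal]
  simp_rw [← integral_cexp_sum_mul_pi_cauchyMeasure]
  rw [integral_integral_swap]
  · congr 1; ext z
    congr 1; ext c
    congr 3
    simp_rw [Finset.mul_sum]
    rw [Finset.sum_comm]
    exact Finset.sum_congr rfl fun i _ => Finset.sum_congr rfl fun t _ => by ring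
  · refine Integrable.of_bound (C := 1) (Continuous.aestronglyMeasurable (by fun_prop))
      (.of_forall fun p => ?_)
    simp only [Function.uncurry]
    rw [Complex.norm_exp_ofReal_mul_I]

/-- The mean of `|Z|` truncated at height `B`, for a standard Cauchy variable `Z`. -/
def truncMean (B : ℝ) : ℝ := ∫ z, min |z| B ∂(cauchyMeasure 0 1)

lemma truncMean_nonneg {B : ℝ} (hB : 0 ≤ B) : 0 ≤ truncMean B :=
  integral_nonneg fun _ => le_min (abs_nonneg _) hB

lemma truncMean_eq {B : ℝ} (hB : 0 < B) :
    truncMean B = π⁻¹ * Real.log (1 + B ^ 2) + 2 * π⁻¹ * B * arctan B⁻¹ := by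
  rw [truncMean, integral_comp_abs_cauchyMeasure fun x => min x B]
  have hB' : ∀ x ∈ Ioi B, (1 + x ^ 2)⁻¹ * min x B = (1 + x ^ 2)⁻¹ * B := by
    intro x hx; rw [min_eq_right (le_of_lt hx)]
  have hB'' : ∀ x ∈ Ioc 0 B, (1 + x ^ 2)⁻¹ * min x B = x / (1 + x ^ 2) := by
    intro x hx; rw [min_eq_left hx.2]; ring
  have cont : Continuous fun x : ℝ => x / (1 + x ^ 2) :=
    continuous_id.div (by fun_prop) (fun x => by positivity)
  have i1 : IntegrableOn (fun x : ℝ => (1 + x ^ 2)⁻¹ * min x B) (Ioc 0 B) := by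
    refine (integrableOn_congr_fun hB'' measurableSet_Ioc).2 ?_
    exact cont.integrableOn_Ioc
  have i2 : IntegrableOn (fun x : ℝ => (1 + x ^ 2)⁻¹ * min x B) (Ioi B) := by
    refine (integrableOn_congr_fun hB' measurableSet_Ioi).2 ?_
    exact (integrable_inv_one_add_sq.mul_const B).integrableOn
  have hd : ∀ x : ℝ, HasDerivAt (fun x : ℝ => Real.log (1 + x ^ 2) / 2) (x / (1 + x ^ 2)) x := by
    intro x
    have h1 : HasDerivAt (fun x : ℝ => 1 + x ^ 2) (2 * x) x := by
      simpa using (hasDerivAt_pow 2 x).const_add 1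
    have := (h1.log (by positivity)).div_const 2
    convert! this using 1
    ring
  rw [← Ioc_union_Ioi_eq_Ioi hB.le, setIntegral_union (by
      rw [Set.disjoint_left]; intro x hx hx'; exact not_lt.2 hx.2 hx') measurableSet_Ioi i1 i2,
    setIntegral_congr_fun measurableSet_Ioc hB'', setIntegral_congr_fun measurableSet_Ioi hB',
    integral_mul_const, integral_Ioi_inv_one_add_sq, ← intervalIntegral.integral_of_le hB.le,
    intervalIntegral.integral_eq_sub_of_hasDerivAt (fun x _ => hd x)
      (cont.intervalIntegrable _ _), arctan_inv_of_pos hB]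
  simp
  ring

lemma arctan_inv_mem {B : ℝ} (hB : 0 < B) : 0 ≤ arctan B⁻¹ ∧ arctan B⁻¹ ≤ B⁻¹ := by
  have h0 : 0 ≤ arctan B⁻¹ := by rw [← arctan_zero]; exact arctan_strictMono.monotone (by positivity)
  refine ⟨h0, ?_⟩
  have := Real.le_tan h0 (arctan_lt_pi_div_two _)
  rwa [tan_arctan] at this

lemma log_le_two_mul_truncMean {B : ℝ} (hB : 1 ≤ B) : Real.log B ≤ 2 * truncMean B := by
  have hB0 : 0 < B := by linarith
  rw [truncMean_eq hB0]
  have h1 : Real.log (B ^ 2) ≤ Real.log (1 + B ^ 2) := Real.log_le_log (by positivity) (by linarith)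
  rw [Real.log_pow] at h1
  have h2 := (arctan_inv_mem hB0).1
  have h3 : (4 : ℝ)⁻¹ ≤ π⁻¹ := by
    apply inv_anti₀ pi_pos pi_le_four
  have h4 := Real.log_nonneg hB
  have h5 : 0 ≤ 2 * π⁻¹ * B * arctan B⁻¹ := by positivity
  push_cast at h1
  have h6 : 4⁻¹ * (2 * Real.log B) ≤ π⁻¹ * Real.log (1 + B ^ 2) := by
    apply mul_le_mul h3 h1 (by positivity) (by positivity)
  linarith

lemma truncMean_le {B : ℝ} (hB : 4 ≤ B) : truncMean B ≤ 2 * Real.log B := by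
  have hB0 : 0 < B := by linarith
  rw [truncMean_eq hB0]
  have h1 : Real.log (1 + B ^ 2) ≤ Real.log (B ^ 3) :=
    Real.log_le_log (by positivity) (by nlinarith [mul_self_nonneg B, mul_self_nonneg (B - 1)])
  rw [Real.log_pow] at h1
  have h2 := (arctan_inv_mem hB0).2
  have h3 : π⁻¹ ≤ 3⁻¹ := inv_anti₀ (by norm_num) pi_gt_three.le
  have h4 : 1 ≤ Real.log B := by
    rw [Real.le_log_iff_exp_le hB0]
    linarith [Real.exp_one_lt_d9]
  have h5 : B * arctan B⁻¹ ≤ 1 := by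
    calc B * arctan B⁻¹ ≤ B * B⁻¹ := by gcongr
      _ = 1 := mul_inv_cancel₀ hB0.ne'
  push_cast at h1
  have h6 : π⁻¹ * Real.log (1 + B ^ 2) ≤ 3⁻¹ * (3 * Real.log B) := by
    apply mul_le_mul h3 h1 (Real.log_nonneg (by nlinarith)) (by positivity)
  have h7 : 2 * π⁻¹ * (B * arctan B⁻¹) ≤ 2 * 3⁻¹ * 1 := by
    have := (arctan_inv_mem hB0).1
    gcongr
  linarith

lemma cauchyMeasure_real_lt_abs_le {M : ℝ} (hM : 0 < M) :
    (cauchyMeasure 0 1).real {z | M < |z|} ≤ M⁻¹ := by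
  have hm : MeasurableSet {z : ℝ | M < |z|} := measurableSet_lt (by fun_prop) (by fun_prop)
  have h0 : ∀ x : ℝ, (1 + x ^ 2)⁻¹ * (Ioi M).indicator 1 x
      = (Ioi M).indicator (fun u => (1 + u ^ 2)⁻¹) x := by
    intro x
    by_cases h : M < x <;> simp [indicator, h]
  have h1 : {z : ℝ | M < |z|}.indicator (1 : ℝ → ℝ) = fun z => (Ioi M).indicator 1 |z| := by
    ext z; simp [indicator]
  rw [← integral_indicator_one hm, h1, integral_comp_abs_cauchyMeasure]
  simp_rw [h0]
  rw [setIntegral_indicator measurableSet_Ioi,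
    Set.inter_eq_right.2 (Ioi_subset_Ioi hM.le), integral_Ioi_inv_one_add_sq,
    ← arctan_inv_of_pos hM]
  have h3 : π⁻¹ ≤ 3⁻¹ := inv_anti₀ (by norm_num) pi_gt_three.le
  have h2 := arctan_inv_mem hM
  have : π⁻¹ * arctan M⁻¹ ≤ 3⁻¹ * M⁻¹ := by
    apply mul_le_mul h3 h2.2 h2.1 (by positivity)
  have : 0 < M⁻¹ := by positivity
  linarith

lemma cauchyMeasure_ae_ne_zero : ∀ᵐ z ∂(cauchyMeasure 0 1), z ≠ 0 := by
  rw [cauchyMeasure_of_scale_ne_zero 0 one_ne_zero]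
  exact (withDensity_absolutelyContinuous _ _).ae_le (Measure.ae_ne volume 0)

/-! ### Hashing sketches -/

/-- The hashing sketch of the vector `y` with hash function `h` and weights `c`. -/
def hashSketch {R n : ℕ} (h : Fin n → Fin R) (c y : Fin n → ℝ) : Fin R → ℝ :=
  (hashMatrix h * Matrix.diagonal c).mulVec y

lemma hashSketch_apply {R n : ℕ} (h : Fin n → Fin R) (c y : Fin n → ℝ) (t : Fin R) :
    hashSketch h c y t = ∑ i, c i * (if h i = t then y i else 0) := by
  simp [hashSketch, Matrix.mulVec, dotProduct, hashMatrix, Matrix.mul_diagonal]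

/-- The uniform law on hash functions `[n] → [R]`. -/
abbrev hashLaw (R n : ℕ) : Measure (Fin n → Fin R) :=
  Measure.pi fun _ => uniformOn (Set.univ : Set (Fin R))

/-- The law of `n` independent standard Cauchy variables. -/
abbrev cauchyLaw (n : ℕ) : Measure (Fin n → ℝ) := Measure.pi fun _ => cauchyMeasure 0 1

instance instIsProbabilityMeasureUniformOnFin {R : ℕ} [NeZero R] :
    IsProbabilityMeasure (uniformOn (Set.univ : Set (Fin R))) :=
  isProbabilityMeasure_uniformOn Set.finite_univ Set.univ_nonempty

lemma integral_uniformOn_univ {R : ℕ} (f : Fin R → ℝ) :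
    ∫ r, f r ∂(uniformOn (Set.univ : Set (Fin R))) = (R : ℝ)⁻¹ * ∑ r, f r := by
  rw [integral_fintype (Integrable.of_finite), Finset.mul_sum]
  refine Finset.sum_congr rfl fun r _ => ?_
  simp [Measure.real, uniformOn_univ]

/-! ### The sparse Cauchy sketch does not expand much -/

/-- For linear forms in independent Cauchy variables, the `ℓ₁`-norm exceeds `A` only if one of them
is more than `M` times as large as its scale, or if their truncations sum up to more than `A`. -/
lemma cauchy_real_lt_sum_abs_le {ι κ : Type*} [Fintype ι] [Fintype κ] (a : κ → ι → ℝ)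
    {M A : ℝ} (hM : 0 < M) (hA : 0 < A) :
    (Measure.pi fun _ : ι => cauchyMeasure 0 1).real {c | A < ∑ t, |∑ i, c i * a t i|}
      ≤ Fintype.card κ * M⁻¹ + (∑ t, ∑ i, |a t i|) * truncMean M / A := by
  set P := Measure.pi fun _ : ι => cauchyMeasure 0 1 with hP
  let w : κ → ℝ := fun t => ∑ i, |a t i|
  have hw : ∀ t, 0 ≤ w t := fun t => Finset.sum_nonneg fun i _ => abs_nonneg _
  let X : κ → (ι → ℝ) → ℝ := fun t c => ∑ i, c i * a t i
  have hX : ∀ t, Continuous (X t) := fun t => by fun_prop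
  let Y : κ → (ι → ℝ) → ℝ := fun t c => min |X t c| (M * w t)
  have hY0 : ∀ t c, 0 ≤ Y t c := fun t c => le_min (abs_nonneg _) (mul_nonneg hM.le (hw t))
  have hYint : ∀ t, Integrable (Y t) P := fun t => by
    refine Integrable.of_bound (C := M * w t)
      (Continuous.aestronglyMeasurable ((hX t).abs.min continuous_const)) (.of_forall fun c => ?_)
    rw [Real.norm_eq_abs, abs_of_nonneg (hY0 t c)]
    exact min_le_right _ _
  have hYmean : ∀ t, ∫ c, Y t c ∂P = w t * truncMean M := by
    intro t
    have h1 : ∫ c, Y t c ∂P = ∫ x, min |x| (M * w t) ∂(P.map (X t)) := by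
      rw [integral_map (hX t).aemeasurable (Continuous.aestronglyMeasurable (by fun_prop))]
    rw [h1, map_sum_mul_pi_cauchyMeasure, integral_map (by fun_prop)
      (Continuous.aestronglyMeasurable (by fun_prop)), truncMean, ← integral_const_mul]
    congr 1; ext z
    rw [abs_mul, abs_of_nonneg (hw t), mul_comm M, mul_min_of_nonneg _ _ (hw t)]
  have htail : ∀ t, P.real {c | M * w t < |X t c|} ≤ M⁻¹ := by
    intro t
    have hm : MeasurableSet {x : ℝ | M * w t < |x|} :=
      measurableSet_lt (by fun_prop) (by fun_prop)
    have h1 : P.real {c | M * w t < |X t c|} = (P.map (X t)).real {x | M * w t < |x|} := by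
      rw [map_measureReal_apply (hX t).measurable hm]; rfl
    rw [h1, map_sum_mul_pi_cauchyMeasure, map_measureReal_apply (by fun_prop) hm]
    refine le_trans (measureReal_mono ?_) (cauchyMeasure_real_lt_abs_le hM)
    intro z hz
    simp only [mem_preimage, mem_ofPred_eq, abs_mul] at hz ⊢
    change M * w t < |w t| * |z| at hz
    rw [abs_of_nonneg (hw t), mul_comm M] at hz
    exact lt_of_mul_lt_mul_left hz (hw t)
  have hsub : {c | A < ∑ t, |∑ i, c i * a t i|}
      ⊆ (⋃ t, {c | M * w t < |X t c|}) ∪ {c | A ≤ ∑ t, Y t c} := by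
    intro c hc
    by_cases hex : ∃ t, M * w t < |X t c|
    · exact Or.inl (mem_iUnion.2 hex)
    · push Not at hex
      refine Or.inr ?_
      have : ∑ t, Y t c = ∑ t, |X t c| :=
        Finset.sum_congr rfl fun t _ => min_eq_left (hex t)
      change A ≤ ∑ t, Y t c
      rw [this]; exact le_of_lt hc
  refine (measureReal_mono hsub).trans ((measureReal_union_le _ _).trans (add_le_add ?_ ?_))
  · refine (measureReal_iUnion_fintype_le _).trans ((Finset.sum_le_sum fun t _ => htail t).trans ?_)
    simp
  · have := mul_meas_ge_le_integral_of_nonneg (μ := P) (f := fun c => ∑ t, Y t c)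
      (.of_forall fun c => Finset.sum_nonneg fun t _ => hY0 t c)
      (integrable_finsetSum _ fun t _ => hYint t) A
    rw [integral_finsetSum _ fun t _ => hYint t] at this
    simp_rw [hYmean] at this
    rw [← Finset.sum_mul] at this
    rw [le_div_iff₀ hA, mul_comm]
    exact this

/-- For any fixed hash function, the images of the columns of `U` are not much longer than the
columns: the linear forms involved have scales of sum `‖U‖₁`. -/
lemma cauchySketch_upper {R n k : ℕ} (h : Fin n → Fin R) (U : Matrix (Fin n) (Fin k) ℝ)
    {M A : ℝ} (hM : 0 < M) (hA : 0 < A) :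
    (cauchyLaw n).real {c | A < ∑ j, l1Norm (hashSketch h c (U.col j))}
      ≤ R * k * M⁻¹ + entryL1Norm U * truncMean M / A := by
  have := cauchy_real_lt_sum_abs_le (ι := Fin n) (κ := Fin k × Fin R)
    (fun p i => if h i = p.2 then U i p.1 else 0) hM hA
  have hU : ∑ p : Fin k × Fin R, ∑ i, |if h i = p.2 then U i p.1 else 0| = entryL1Norm U := by
    rw [entryL1Norm, Fintype.sum_prod_type, Finset.sum_comm (s := Finset.univ (α := Fin n))]
    refine Finset.sum_congr rfl fun j _ => ?_
    rw [Finset.sum_comm]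
    refine Finset.sum_congr rfl fun i _ => ?_
    simp [apply_ite]
  rw [hU] at this
  simp only [Fintype.card_prod, Fintype.card_fin, Fintype.sum_prod_type] at this
  simp only [l1Norm, hashSketch_apply]
  push_cast at this
  rwa [mul_comm (R : ℝ)]

/-! ### The sparse Cauchy sketch does not contract flat vectors -/

lemma exp_neg_le_one_sub_half {v : ℝ} (h0 : 0 ≤ v) : rexp (-v) ≤ 1 - min v 1 / 2 := by
  have key : ∀ u : ℝ, 0 ≤ u → u ≤ 1 → rexp (-u) ≤ 1 - u / 2 := by
    intro u h0 h1
    rw [Real.exp_neg, inv_le_comm₀ (Real.exp_pos _) (by linarith)]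
    refine le_trans ?_ (Real.add_one_le_exp u)
    rw [inv_le_iff_one_le_mul₀ (by linarith)]
    nlinarith
  rcases le_total v 1 with h | h
  · rw [min_eq_left h]; exact key v h0 h
  · rw [min_eq_right h]
    exact (Real.exp_le_exp.2 (by linarith)).trans (key 1 zero_le_one le_rfl)

lemma mul_min_mul_min_le {s x y τ B : ℝ} (hs : 0 ≤ s) (hx : 0 ≤ x) (hy : 0 ≤ y) (hτ : 0 ≤ τ)
    (hB : 0 ≤ B) (hsτB : s * τ * B ≤ 1) : s * min x τ * min y B ≤ min (s * x * y) 1 := by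
  have h1 : 0 ≤ min x τ := le_min hx hτ
  refine le_min ?_ (le_trans ?_ hsτB)
  · gcongr <;> exact min_le_left _ _
  · gcongr <;> exact min_le_right _ _

/-- The product over coordinates of the averages over rows is bounded by a function of the truncated
values `min |z r| B` only. The condition `s * τ * B ≤ 1` keeps `s * min |y i| τ * min |z r| B` in the
range where `1 - e^{-v}` is comparable to `v`. -/
lemma prod_average_exp_le {R n : ℕ} [NeZero R] (y : Fin n → ℝ) (z : Fin R → ℝ) {s τ B L : ℝ}
    (hs : 0 ≤ s) (hτ : 0 ≤ τ) (hB : 0 ≤ B) (hsτB : s * τ * B ≤ 1)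
    (hL : L ≤ ∑ i, min |y i| τ) :
    ∏ i, ((R : ℝ)⁻¹ * ∑ r, rexp (-(s * |y i| * |z r|)))
      ≤ ∏ r, rexp (-(s * L / (2 * R)) * min |z r| B) := by
  have hR : (0 : ℝ) < R := by exact_mod_cast Nat.pos_of_ne_zero (NeZero.ne R)
  set m := ∑ r, min |z r| B with hm
  have hm0 : 0 ≤ m := Finset.sum_nonneg fun r _ => le_min (abs_nonneg _) hB
  have hfac : ∀ i, (R : ℝ)⁻¹ * ∑ r, rexp (-(s * |y i| * |z r|))
      ≤ rexp (-(s * min |y i| τ / (2 * R)) * m) := by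
    intro i
    have h1 : ∀ r, rexp (-(s * |y i| * |z r|)) ≤ 1 - s * min |y i| τ / 2 * min |z r| B := by
      intro r
      refine (exp_neg_le_one_sub_half (by positivity)).trans ?_
      have := mul_min_mul_min_le hs (abs_nonneg (y i)) (abs_nonneg (z r)) hτ hB hsτB
      linarith
    calc (R : ℝ)⁻¹ * ∑ r, rexp (-(s * |y i| * |z r|))
        ≤ (R : ℝ)⁻¹ * ∑ r, (1 - s * min |y i| τ / 2 * min |z r| B) := by
          gcongr with r; exact h1 r
      _ = -(s * min |y i| τ / (2 * R)) * m + 1 := by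
          rw [Finset.sum_sub_distrib, ← Finset.mul_sum, ← hm]
          simp
          field_simp
          ring
      _ ≤ _ := Real.add_one_le_exp _
  refine (Finset.prod_le_prod (fun i _ => by positivity) fun i _ => hfac i).trans ?_
  rw [← Real.exp_sum, ← Real.exp_sum, ← Finset.sum_mul, ← Finset.mul_sum, ← hm]
  refine Real.exp_le_exp.2 (mul_le_mul_of_nonneg_right ?_ hm0)
  rw [Finset.sum_neg_distrib, neg_le_neg_iff, ← Finset.sum_div, ← Finset.mul_sum]
  gcongr

lemma integral_exp_neg_mul_min_le {κ B : ℝ} (hκ : 0 ≤ κ) (hB : 0 ≤ B) (h : κ * B ≤ 1) :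
    ∫ z, rexp (-κ * min |z| B) ∂(cauchyMeasure 0 1) ≤ rexp (-(κ / 2 * truncMean B)) := by
  have hint : Integrable (fun z : ℝ => min |z| B) (cauchyMeasure 0 1) := by
    refine Integrable.of_bound (C := B) (Continuous.aestronglyMeasurable (by fun_prop))
      (.of_forall fun z => ?_)
    rw [Real.norm_eq_abs, abs_of_nonneg (le_min (abs_nonneg _) hB)]
    exact min_le_right _ _
  have h1 : ∀ z : ℝ, rexp (-κ * min |z| B) ≤ 1 - κ / 2 * min |z| B := by
    intro z
    have h0 : 0 ≤ min |z| B := le_min (abs_nonneg _) hB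
    have h2 : κ * min |z| B ≤ 1 := le_trans (by gcongr; exact min_le_right _ _) h
    have := exp_neg_le_one_sub_half (mul_nonneg hκ h0)
    rw [min_eq_left h2, ← neg_mul] at this
    linarith
  calc ∫ z, rexp (-κ * min |z| B) ∂(cauchyMeasure 0 1)
      ≤ ∫ z, (1 - κ / 2 * min |z| B) ∂(cauchyMeasure 0 1) := by
        refine integral_mono_of_nonneg (.of_forall fun z => (Real.exp_pos _).le)
          ((integrable_const _).sub (hint.const_mul _)) (.of_forall h1)
    _ = -(κ / 2 * truncMean B) + 1 := by
        rw [integral_sub (integrable_const _) (hint.const_mul _), integral_const_mul, truncMean]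
        simp; ring
    _ ≤ _ := Real.add_one_le_exp _

/-- The Laplace transform of the `ℓ₁`-norm of a sparse Cauchy sketch. By duality the sketch is
exchanged for a product over coordinates in which the hash values are independent. -/
lemma cauchySketch_laplace_le {R n : ℕ} [NeZero R] (y : Fin n → ℝ) {s τ B L : ℝ}
    (hs : 0 ≤ s) (hτ : 0 ≤ τ) (hB : 0 ≤ B) (hsτB : s * τ * B ≤ 1) (hL0 : 0 ≤ L)
    (hL : L ≤ ∑ i, min |y i| τ) (hsLB : s * L * B ≤ 2 * R) :
    ∫ h, ∫ c, rexp (-s * l1Norm (hashSketch h c y)) ∂(cauchyLaw n) ∂(hashLaw R n)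
      ≤ rexp (-(s * L / 4 * truncMean B)) := by
  have hR : (0 : ℝ) < R := by exact_mod_cast Nat.pos_of_ne_zero (NeZero.ne R)
  have hdual : ∀ h : Fin n → Fin R, ∫ c, rexp (-s * l1Norm (hashSketch h c y)) ∂(cauchyLaw n)
      = ∫ z, ∏ i, rexp (-(s * |y i| * |z (h i)|)) ∂(cauchyLaw R) := by
    intro h
    have := integral_exp_neg_sum_abs_swap (ι := Fin n) (κ := Fin R)
      (fun t i => if h i = t then s * y i else 0)
    convert! this using 4 with c z
    · rw [neg_mul, l1Norm, Finset.mul_sum]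
      congr 2; ext t
      rw [hashSketch_apply, ← abs_of_nonneg hs, ← abs_mul, Finset.mul_sum, abs_of_nonneg hs]
      congr 2; ext i
      split_ifs <;> ring
    · rw [← Real.exp_sum, Finset.sum_neg_distrib]
      congr 3; ext i
      simp [abs_mul, abs_of_nonneg hs]
      ring
  simp_rw [hdual]
  rw [integral_integral_swap]
  · calc ∫ z, ∫ h, ∏ i, rexp (-(s * |y i| * |z (h i)|)) ∂(hashLaw R n) ∂(cauchyLaw R)
        = ∫ z, ∏ i, ((R : ℝ)⁻¹ * ∑ r, rexp (-(s * |y i| * |z r|))) ∂(cauchyLaw R) := by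
          congr 1; ext z
          rw [integral_fintype_prod_eq_prod
            (μ := fun _ : Fin n => uniformOn (Set.univ : Set (Fin R)))
            (fun i r => rexp (-(s * |y i| * |z r|)))]
          simp_rw [integral_uniformOn_univ]
      _ ≤ ∫ z, ∏ r, rexp (-(s * L / (2 * R)) * min |z r| B) ∂(cauchyLaw R) := by
          refine integral_mono_of_nonneg (.of_forall fun z => Finset.prod_nonneg fun i _ => by
            positivity) ?_ (.of_forall fun z => prod_average_exp_le y z hs hτ hB hsτB hL)
          refine Integrable.of_bound (C := 1) (Continuous.aestronglyMeasurable (by fun_prop))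
            (.of_forall fun z => ?_)
          rw [← Real.exp_sum, Real.norm_eq_abs, Real.abs_exp, Real.exp_le_one_iff]
          refine Finset.sum_nonpos fun r _ => ?_
          have : 0 ≤ min |z r| B := le_min (abs_nonneg _) hB
          rw [neg_mul, neg_nonpos]
          positivity
      _ = (∫ z, rexp (-(s * L / (2 * R)) * min |z| B) ∂(cauchyMeasure 0 1)) ^ R := by
          rw [integral_fintype_prod_eq_prod (μ := fun _ : Fin R => cauchyMeasure 0 1)
            (fun _ z => rexp (-(s * L / (2 * R)) * min |z| B))]
          simp
      _ ≤ rexp (-(s * L / (2 * R) / 2 * truncMean B)) ^ R := by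
          refine pow_le_pow_left₀ (integral_nonneg fun z => (Real.exp_pos _).le) ?_ _
          refine integral_exp_neg_mul_min_le (by positivity) hB ?_
          rw [div_mul_eq_mul_div, div_le_one (by positivity)]
          exact hsLB
      _ = _ := by
          rw [← Real.exp_nat_mul]
          congr 1
          field_simp
          ring
  · refine Integrable.of_bound (C := 1) ?_ (.of_forall fun p => ?_)
    · refine Measurable.aestronglyMeasurable ?_
      refine measurable_from_prod_countable_right fun h => ?_
      simp only [Function.uncurry]
      fun_prop
    · simp only [Function.uncurry]
      rw [← Real.exp_sum, Real.norm_eq_abs, Real.abs_exp, Real.exp_le_one_iff]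
      refine Finset.sum_nonpos fun r _ => ?_
      rw [neg_nonpos]
      positivity

lemma measurable_hashSketch {R n : ℕ} (y : Fin n → ℝ) (t : Fin R) :
    Measurable fun ω : (Fin n → Fin R) × (Fin n → ℝ) => hashSketch ω.1 ω.2 y t := by
  refine measurable_from_prod_countable_right fun h => ?_
  simp_rw [hashSketch_apply]
  fun_prop

/-- A vector which keeps an `ℓ₁`-mass of at least `L` when its entries are capped at `τ` is
contracted by the sparse Cauchy sketch with exponentially small probability only. -/
lemma cauchySketch_lower {R n : ℕ} [NeZero R] (y : Fin n → ℝ) {s τ B L : ℝ} (a : ℝ)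
    (hs : 0 ≤ s) (hτ : 0 ≤ τ) (hB : 0 ≤ B) (hsτB : s * τ * B ≤ 1) (hL0 : 0 ≤ L)
    (hL : L ≤ ∑ i, min |y i| τ) (hsLB : s * L * B ≤ 2 * R) :
    ((hashLaw R n).prod (cauchyLaw n)).real {ω | l1Norm (hashSketch ω.1 ω.2 y) ≤ a}
      ≤ rexp (s * a - s * L / 4 * truncMean B) := by
  have hmeas : Measurable fun ω : (Fin n → Fin R) × (Fin n → ℝ) =>
      l1Norm (hashSketch ω.1 ω.2 y) := by
    unfold l1Norm
    exact Finset.measurable_sum _ fun t _ => (measurable_hashSketch y t).abs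
  have hint : Integrable (fun ω : (Fin n → Fin R) × (Fin n → ℝ) =>
      rexp (-s * l1Norm (hashSketch ω.1 ω.2 y))) ((hashLaw R n).prod (cauchyLaw n)) := by
    refine Integrable.of_bound (C := 1) (hmeas.const_mul _).exp.aestronglyMeasurable
      (.of_forall fun ω => ?_)
    rw [Real.norm_eq_abs, Real.abs_exp, Real.exp_le_one_iff, neg_mul, neg_nonpos]
    exact mul_nonneg hs (Finset.sum_nonneg fun t _ => abs_nonneg _)
  have h1 := measure_le_le_exp_mul_mgf (μ := (hashLaw R n).prod (cauchyLaw n)) a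
    (neg_nonpos.2 hs) hint
  rw [mgf, integral_prod _ hint] at h1
  refine h1.trans ?_
  rw [sub_eq_add_neg, Real.exp_add, neg_neg]
  gcongr
  exact cauchySketch_laplace_le y hs hτ hB hsτB hL0 hL hsLB

/-! ### The CountSketch is an `ℓ₂` subspace embedding -/

/-- The law of a uniformly random sign. -/
abbrev signMeasure : Measure ℝ := uniformOn ({1, -1} : Set ℝ)

/-- The law of `n` independent uniformly random signs. -/
abbrev signLaw (n : ℕ) : Measure (Fin n → ℝ) := Measure.pi fun _ => signMeasure

instance instIsProbabilityMeasureSignMeasure : IsProbabilityMeasure signMeasure :=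
  isProbabilityMeasure_uniformOn (by simp) (by simp)

lemma signMeasure_ae : ∀ᵐ x ∂signMeasure, x = 1 ∨ x = -1 := by
  have h := uniformOn_self (Ω := ℝ) (s := {1, -1}) (by simp) (by simp)
  exact (prob_compl_eq_zero_iff (μ := signMeasure)
    (s := {1, -1}) (Set.Finite.measurableSet (by simp))).2 h

lemma signMeasure_neg : MeasurePreserving (fun x : ℝ => -x) signMeasure signMeasure := by
  refine ⟨measurable_neg, ?_⟩
  ext s hs
  rw [Measure.map_apply measurable_neg hs]
  simp only [signMeasure, uniformOn]
  have hm : MeasurableSet ({1, -1} : Set ℝ) := Set.Finite.measurableSet (by simp)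
  rw [cond_apply hm, cond_apply hm]
  congr 1
  have : ({1, -1} : Set ℝ) ∩ (fun x : ℝ => -x) ⁻¹' s = (fun x : ℝ => -x) '' ({1, -1} ∩ s) := by
    rw [Set.image_neg_eq_neg]
    ext x
    simp [or_comm]
  rw [this, Measure.count_injective_image neg_injective]

lemma signLaw_ae (n : ℕ) : ∀ᵐ σ ∂(signLaw n), ∀ i, σ i = 1 ∨ σ i = -1 :=
  ae_all_iff.2 fun i =>
    (measurePreserving_eval (fun _ : Fin n => signMeasure) i).quasiMeasurePreserving.ae
      signMeasure_ae

/-- Flipping the `m`-th sign shows that a random variable which is odd in it has mean zero. -/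
lemma integral_signLaw_eq_zero {n : ℕ} (m : Fin n) {f : (Fin n → ℝ) → ℝ}
    (hc : Continuous f) (hf : ∀ σ, f (fun r => if r = m then -σ r else σ r) = -f σ) :
    ∫ σ, f σ ∂(signLaw n) = 0 := by
  have hmp : MeasurePreserving (fun (σ : Fin n → ℝ) r => if r = m then -σ r else σ r)
      (signLaw n) (signLaw n) := by
    refine measurePreserving_pi (fun _ => signMeasure) (fun _ => signMeasure)
      (f := fun r x => if r = m then -x else x) fun r => ?_
    by_cases h : r = m
    · simpa [h] using signMeasure_neg
    · simpa [h] using! MeasurePreserving.id signMeasure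
  have := integral_map hmp.aemeasurable (f := f) hc.aestronglyMeasurable
  rw [hmp.map_eq] at this
  simp_rw [hf, integral_neg] at this
  linarith

lemma integral_signLaw_quartic {n : ℕ} {i j k l : Fin n} (hij : i ≠ j) (hkl : k ≠ l) :
    ∫ σ, σ i * σ j * (σ k * σ l) ∂(signLaw n)
      = if (k = i ∧ l = j) ∨ (k = j ∧ l = i) then 1 else 0 := by
  split_ifs with h
  · have : ∀ᵐ σ ∂(signLaw n), σ i * σ j * (σ k * σ l) = 1 := by
      filter_upwards [signLaw_ae n] with σ hσ
      rcases h with ⟨rfl, rfl⟩ | ⟨rfl, rfl⟩ <;>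
      rcases hσ k with h1 | h1 <;> rcases hσ l with h2 | h2 <;> simp [h1, h2]
    rw [integral_congr_ae this]; simp
  -- If the pairs differ, `i` or `j` occurs exactly once.
  · by_cases hi : i = k ∨ i = l
    · have hj : j ≠ k ∧ j ≠ l := by
        rcases hi with rfl | rfl
        · exact ⟨hij.symm, fun e => h (Or.inl ⟨rfl, e.symm⟩)⟩
        · exact ⟨fun e => h (Or.inr ⟨e.symm, rfl⟩), hij.symm⟩
      refine integral_signLaw_eq_zero j (by fun_prop) fun σ => ?_
      simp [hij, hj.1.symm, hj.2.symm]
    · push Not at hi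
      refine integral_signLaw_eq_zero i (by fun_prop) fun σ => ?_
      simp [hij.symm, hi.1.symm, hi.2.symm]

lemma integrable_quartic {n : ℕ} (i j k l : Fin n) (a : ℝ) :
    Integrable (fun σ : Fin n → ℝ => a * (σ i * σ j * (σ k * σ l))) (signLaw n) := by
  refine Integrable.of_bound (C := |a|) (Continuous.aestronglyMeasurable (by fun_prop)) ?_
  filter_upwards [signLaw_ae n] with σ hσ
  have : ∀ r, |σ r| = 1 := fun r => by rcases hσ r with h | h <;> simp [h]
  simp [this]

/-- The second moment of a homogeneous quadratic form in independent random signs whose matrix has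
zero diagonal. -/
lemma integral_signLaw_sq_le {n : ℕ} (B : Fin n → Fin n → ℝ) (hB : ∀ i, B i i = 0) :
    ∫ σ, (∑ i, ∑ j, σ i * σ j * B i j) ^ 2 ∂(signLaw n) ≤ 2 * ∑ i, ∑ j, B i j ^ 2 := by
  have hexp : ∀ σ : Fin n → ℝ, (∑ i, ∑ j, σ i * σ j * B i j) ^ 2
      = ∑ i, ∑ j, ∑ k, ∑ l, B i j * B k l * (σ i * σ j * (σ k * σ l)) := by
    intro σ
    rw [sq, Finset.sum_mul]
    refine Finset.sum_congr rfl fun i _ => ?_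
    rw [Finset.sum_mul]
    refine Finset.sum_congr rfl fun j _ => ?_
    rw [Finset.mul_sum]
    refine Finset.sum_congr rfl fun k _ => ?_
    rw [Finset.mul_sum]
    exact Finset.sum_congr rfl fun l _ => by ring
  simp_rw [hexp]
  have hI := fun i j k l => integrable_quartic (n := n) i j k l (B i j * B k l)
  rw [integral_finsetSum _ fun i _ => integrable_finsetSum _ fun j _ => integrable_finsetSum _
    fun k _ => integrable_finsetSum _ fun l _ => hI i j k l, Finset.mul_sum]
  have hterm : ∀ i, ∫ σ, ∑ j, ∑ k, ∑ l, B i j * B k l * (σ i * σ j * (σ k * σ l)) ∂(signLaw n)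
      ≤ ∑ j, (B i j ^ 2 + B i j * B j i) := by
    intro i
    rw [integral_finsetSum _ fun j _ => integrable_finsetSum _
      fun k _ => integrable_finsetSum _ fun l _ => hI i j k l]
    refine Finset.sum_le_sum fun j _ => ?_
    rw [integral_finsetSum _ fun k _ => integrable_finsetSum _ fun l _ => hI i j k l]
    rw [Finset.sum_congr rfl fun k _ => integral_finsetSum _ fun l _ => hI i j k l]
    simp_rw [integral_const_mul]
    by_cases hij : i = j
    · subst hij; simp [hB]
    have : ∀ k l, B i j * B k l * ∫ σ, σ i * σ j * (σ k * σ l) ∂(signLaw n)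
        = (if k = i then if l = j then B i j * B i j else 0 else 0)
          + if k = j then if l = i then B i j * B j i else 0 else 0 := by
      intro k l
      by_cases hkl : k = l
      · subst hkl
        rw [hB]
        by_cases h1 : k = i
        · subst h1; simp [hij]
        · simp [h1]
      · rw [integral_signLaw_quartic hij hkl]
        by_cases h1 : k = i
        · subst h1; by_cases h2 : l = j <;> simp [h2, hij]
        · by_cases h2 : k = j
          · subst h2; by_cases h3 : l = i <;> simp [h3, h1]
          · simp [h1, h2]
    simp_rw [this, Finset.sum_add_distrib]
    simp [sq]
  refine (Finset.sum_le_sum fun i _ => hterm i).trans ?_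
  have h2 : ∑ i, ∑ j, (B i j ^ 2 + B i j * B j i)
      ≤ ∑ i, ∑ j, (B i j ^ 2 + (B i j ^ 2 + B j i ^ 2) / 2) := by
    gcongr with i _ j _
    nlinarith [sq_nonneg (B i j - B j i)]
  refine h2.trans (le_of_eq ?_)
  have h3 : ∑ i, ∑ j, B j i ^ 2 = ∑ i, ∑ j, B i j ^ 2 := Finset.sum_comm
  simp_rw [← Finset.mul_sum, Finset.sum_add_distrib, ← Finset.sum_div, Finset.sum_add_distrib]
  rw [h3]; ring

lemma integral_hashLaw_collision {R n : ℕ} [NeZero R] {i j : Fin n} (hij : i ≠ j) :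
    ∫ h, (if h i = h j then (1 : ℝ) else 0) ∂(hashLaw R n) = (R : ℝ)⁻¹ := by
  have hR : (R : ℝ) ≠ 0 := by exact_mod_cast NeZero.ne R
  -- The collision indicator as a sum of products over coordinates, to integrate it factorwise.
  have h1 : ∀ h : Fin n → Fin R, (if h i = h j then (1 : ℝ) else 0)
      = ∑ r, ∏ m, if m = i ∨ m = j then (if h m = r then (1 : ℝ) else 0) else 1 := by
    intro h
    have : ∀ r, (∏ m, if m = i ∨ m = j then (if h m = r then (1 : ℝ) else 0) else 1)
        = (if h i = r then 1 else 0) * (if h j = r then 1 else 0) := by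
      intro r
      rw [Finset.prod_eq_mul i j hij (by intro c _ hc; simp [hc.1, hc.2]) (by simp) (by simp)]
      simp
    simp_rw [this]
    simp [eq_comm]
  simp_rw [h1]
  rw [integral_finsetSum _ fun r _ => Integrable.of_finite]
  have h2 : ∀ r : Fin R, ∫ h : Fin n → Fin R,
      ∏ m, (if m = i ∨ m = j then (if h m = r then (1 : ℝ) else 0) else 1) ∂(hashLaw R n)
      = (R : ℝ)⁻¹ * (R : ℝ)⁻¹ := by
    intro r
    rw [integral_fintype_prod_eq_prod
      (μ := fun _ : Fin n => uniformOn (Set.univ : Set (Fin R)))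
      (fun m x => if m = i ∨ m = j then (if x = r then (1 : ℝ) else 0) else 1)]
    simp_rw [integral_uniformOn_univ]
    rw [Finset.prod_eq_mul i j hij (by intro c _ hc; simp [hc.1, hc.2, hR]) (by simp) (by simp)]
    simp
  simp_rw [h2]
  simp [hR]

/-- The entry `(p, q)` of the error `SᵀS - I` of a CountSketch `S` as a bilinear form: the
contribution of the colliding pairs of distinct coordinates. -/
def collisionForm {R n : ℕ} (h : Fin n → Fin R) (σ p q : Fin n → ℝ) : ℝ :=
  ∑ i, ∑ j, σ i * σ j * (if i ≠ j ∧ h i = h j then p i * q j else 0)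

lemma measurable_collisionForm {R n : ℕ} (p q : Fin n → ℝ) :
    Measurable fun ω : (Fin n → Fin R) × (Fin n → ℝ) => collisionForm ω.1 ω.2 p q := by
  refine measurable_from_prod_countable_right fun h => ?_
  change Measurable fun σ => collisionForm h σ p q
  unfold collisionForm
  fun_prop

lemma integrable_collisionForm_sq {R n : ℕ} [NeZero R] (p q : Fin n → ℝ) :
    Integrable (fun ω : (Fin n → Fin R) × (Fin n → ℝ) => collisionForm ω.1 ω.2 p q ^ 2)
      ((hashLaw R n).prod (signLaw n)) := by
  refine Integrable.of_bound (C := (∑ i, ∑ j, |p i * q j|) ^ 2)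
    ((measurable_collisionForm p q).pow_const 2).aestronglyMeasurable ?_
  filter_upwards [Measure.quasiMeasurePreserving_snd.ae (signLaw_ae n)] with ω hω
  have h1 : ∀ r, |ω.2 r| = 1 := fun r => by rcases hω r with h | h <;> simp [h]
  rw [norm_pow, Real.norm_eq_abs]
  gcongr
  refine (Finset.abs_sum_le_sum_abs _ _).trans (Finset.sum_le_sum fun i _ => ?_)
  refine (Finset.abs_sum_le_sum_abs _ _).trans (Finset.sum_le_sum fun j _ => ?_)
  rw [abs_mul, abs_mul, h1, h1, one_mul, one_mul]
  split_ifs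
  · exact le_rfl
  · rw [abs_zero]; positivity

lemma integral_collisionForm_sq_le {R n : ℕ} [NeZero R] (p q : Fin n → ℝ) :
    ∫ ω, collisionForm ω.1 ω.2 p q ^ 2 ∂((hashLaw R n).prod (signLaw n))
      ≤ 2 * (R : ℝ)⁻¹ * ((∑ i, p i ^ 2) * ∑ j, q j ^ 2) := by
  rw [integral_prod _ (integrable_collisionForm_sq p q)]
  calc ∫ h, ∫ σ, collisionForm h σ p q ^ 2 ∂(signLaw n) ∂(hashLaw R n)
      ≤ ∫ h, 2 * ∑ i, ∑ j, (if i ≠ j ∧ h i = h j then p i * q j else 0) ^ 2 ∂(hashLaw R n) :=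
        integral_mono Integrable.of_finite Integrable.of_finite fun h =>
          integral_signLaw_sq_le _ (by simp)
    _ = 2 * ∑ i, ∑ j, ∫ h, (if i ≠ j ∧ h i = h j then p i * q j else 0) ^ 2 ∂(hashLaw R n) := by
        rw [integral_const_mul, integral_finsetSum _ fun i _ => Integrable.of_finite]
        rw [Finset.sum_congr rfl fun i _ => integral_finsetSum _ fun j _ => Integrable.of_finite]
    _ ≤ 2 * ∑ i, ∑ j, (R : ℝ)⁻¹ * (p i ^ 2 * q j ^ 2) := by
        gcongr with i _ j _
        by_cases hij : i = j
        · simp [hij]; positivity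
        · have : ∀ h : Fin n → Fin R, (if i ≠ j ∧ h i = h j then p i * q j else 0) ^ 2
              = (if h i = h j then (1 : ℝ) else 0) * (p i ^ 2 * q j ^ 2) := by
            intro h
            by_cases h' : h i = h j <;> simp [h', hij, mul_pow]
          simp_rw [this]
          rw [integral_mul_const, integral_hashLaw_collision hij]
    _ = _ := by
        simp_rw [← Finset.mul_sum, ← Finset.sum_mul]
        ring

lemma sum_hashSketch_sq {R n : ℕ} (h : Fin n → Fin R) {σ : Fin n → ℝ}
    (hσ : ∀ i, σ i = 1 ∨ σ i = -1) (y : Fin n → ℝ) :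
    ∑ t, hashSketch h σ y t ^ 2 = ∑ i, y i ^ 2 + collisionForm h σ y y := by
  have h1 : ∀ i, σ i * σ i = 1 := fun i => by rcases hσ i with h | h <;> simp [h]
  simp_rw [hashSketch_apply, sq, Finset.sum_mul_sum]
  rw [Finset.sum_comm, collisionForm, ← Finset.sum_add_distrib]
  refine Finset.sum_congr rfl fun i _ => ?_
  rw [Finset.sum_comm]
  have h2 : ∀ j, ∑ t, σ i * (if h i = t then y i else 0) * (σ j * (if h j = t then y j else 0))
      = (if i = j then y i * y i else 0)
        + σ i * σ j * (if i ≠ j ∧ h i = h j then y i * y j else 0) := by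
    intro j
    have h3 : ∀ t, σ i * (if h i = t then y i else 0) * (σ j * (if h j = t then y j else 0))
        = if h i = t then (if h j = t then σ i * σ j * (y i * y j) else 0) else 0 := by
      intro t; split_ifs <;> ring
    simp_rw [h3]
    rw [Finset.sum_ite_eq]
    by_cases hij : i = j
    · subst hij; simp [h1]
    · by_cases h' : h i = h j
      · simp [hij, h']
      · simp [hij, h', Ne.symm h']
  simp_rw [h2, Finset.sum_add_distrib]
  simp

lemma collisionForm_sum {R n m : ℕ} (h : Fin n → Fin R) (σ : Fin n → ℝ)
    (q : Fin m → Fin n → ℝ) (v : Fin m → ℝ) :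
    collisionForm h σ (∑ a, v a • q a) (∑ a, v a • q a)
      = ∑ a, ∑ b, v a * v b * collisionForm h σ (q a) (q b) := by
  have h1 : ∀ i j, σ i * σ j * (if i ≠ j ∧ h i = h j then
        (∑ a, v a • q a) i * (∑ a, v a • q a) j else 0)
      = ∑ a, ∑ b, v a * v b * (σ i * σ j * (if i ≠ j ∧ h i = h j then q a i * q b j else 0)) := by
    intro i j
    simp only [Finset.sum_apply, Pi.smul_apply, smul_eq_mul]
    split_ifs
    · rw [Finset.sum_mul_sum, Finset.mul_sum]
      refine Finset.sum_congr rfl fun a _ => ?_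
      rw [Finset.mul_sum]
      exact Finset.sum_congr rfl fun b _ => by ring
    · simp
  simp only [collisionForm, h1, Finset.mul_sum]
  calc _ = ∑ i, ∑ a, ∑ j, ∑ b, v a * v b *
        (σ i * σ j * (if i ≠ j ∧ h i = h j then q a i * q b j else 0)) :=
        Finset.sum_congr rfl fun i _ => Finset.sum_comm
    _ = ∑ a, ∑ i, ∑ j, ∑ b, v a * v b *
        (σ i * σ j * (if i ≠ j ∧ h i = h j then q a i * q b j else 0)) := Finset.sum_comm
    _ = ∑ a, ∑ i, ∑ b, ∑ j, v a * v b *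
        (σ i * σ j * (if i ≠ j ∧ h i = h j then q a i * q b j else 0)) :=
        Finset.sum_congr rfl fun a _ => Finset.sum_congr rfl fun i _ => Finset.sum_comm
    _ = _ := Finset.sum_congr rfl fun a _ => Finset.sum_comm

lemma abs_quadratic_form_le {m : ℕ} (v : Fin m → ℝ) (T : Fin m → Fin m → ℝ) :
    |∑ a, ∑ b, v a * v b * T a b| ≤ (∑ a, v a ^ 2) * √(∑ a, ∑ b, T a b ^ 2) := by
  have h := Finset.sum_mul_sq_le_sq_mul_sq (Finset.univ : Finset (Fin m × Fin m))
    (fun p => v p.1 * v p.2) (fun p => T p.1 p.2)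
  simp only [Fintype.sum_prod_type, mul_pow] at h
  rw [← Finset.sum_mul_sum, ← sq] at h
  have h0 : 0 ≤ ∑ a, v a ^ 2 := Finset.sum_nonneg fun _ _ => sq_nonneg _
  rw [← Real.sqrt_sq h0, ← Real.sqrt_mul (by positivity)]
  exact Real.abs_le_sqrt h

/-- A CountSketch with `R` rows shrinks the Euclidean norm on a fixed `m`-dimensional subspace by at
most a factor `2`, except with probability `O(m² / R)`; the `ℓ₁`-norm of the image is at least its
Euclidean norm. -/
lemma countSketch_lower_of_orthonormal {R n m : ℕ} [NeZero R] (q : Fin m → Fin n → ℝ)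
    (hq : ∀ a b, ∑ i, q a i * q b i = if a = b then 1 else 0) :
    ((hashLaw R n).prod (signLaw n)).real
      {ω | ∃ v : Fin m → ℝ, 4 * l1Norm (hashSketch ω.1 ω.2 (∑ a, v a • q a)) ^ 2
        < ∑ i, (∑ a, v a • q a) i ^ 2} ≤ 4 * m ^ 2 * (R : ℝ)⁻¹ := by
  set P := (hashLaw R n).prod (signLaw n)
  let F : (Fin n → Fin R) × (Fin n → ℝ) → ℝ :=
    fun ω => ∑ a, ∑ b, collisionForm ω.1 ω.2 (q a) (q b) ^ 2
  have hFint : Integrable F P := integrable_finsetSum _ fun a _ => integrable_finsetSum _ fun b _ =>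
    integrable_collisionForm_sq _ _
  have hF : ∫ ω, F ω ∂P ≤ 2 * m ^ 2 * (R : ℝ)⁻¹ := by
    have h1 : ∀ a, ∑ i, q a i ^ 2 = 1 := fun a => by simpa [sq] using hq a a
    calc ∫ ω, F ω ∂P = ∑ a, ∑ b, ∫ ω, collisionForm ω.1 ω.2 (q a) (q b) ^ 2 ∂P := by
          rw [integral_finsetSum _ fun a _ => integrable_finsetSum _ fun b _ =>
            integrable_collisionForm_sq _ _]
          exact Finset.sum_congr rfl fun a _ => integral_finsetSum _ fun b _ =>
            integrable_collisionForm_sq _ _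
      _ ≤ ∑ a : Fin m, ∑ b : Fin m, 2 * (R : ℝ)⁻¹ := by
          gcongr with a _ b _
          refine (integral_collisionForm_sq_le _ _).trans ?_
          rw [h1, h1]; simp
      _ = _ := by simp; ring
  -- A Frobenius error below `3 / 4` keeps the squared norm above `1 - 3 / 4 = 1 / 4` of its value.
  have hmarkov := mul_meas_ge_le_integral_of_nonneg (μ := P) (f := F)
    (.of_forall fun ω => Finset.sum_nonneg fun a _ => Finset.sum_nonneg fun b _ => sq_nonneg _)
    hFint (9 / 16)
  have hsub : {ω | ∃ v : Fin m → ℝ, 4 * l1Norm (hashSketch ω.1 ω.2 (∑ a, v a • q a)) ^ 2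
        < ∑ i, (∑ a, v a • q a) i ^ 2} ≤ᵐ[P] {ω | 9 / 16 ≤ F ω} := by
    filter_upwards [Measure.quasiMeasurePreserving_snd.ae (signLaw_ae n)] with ω hω
    rintro ⟨v, hv⟩
    by_contra hlt
    have hlt : F ω < 9 / 16 := not_le.1 hlt
    have hy : ∑ i, (∑ a, v a • q a) i ^ 2 = ∑ a, v a ^ 2 := by
      simp only [Finset.sum_apply, Pi.smul_apply, smul_eq_mul, sq, Finset.sum_mul_sum]
      rw [Finset.sum_comm]
      refine Finset.sum_congr rfl fun a _ => ?_
      rw [Finset.sum_comm]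
      have : ∀ b, ∑ i, v a * q a i * (v b * q b i) = if a = b then v a * v b else 0 := by
        intro b
        rw [← mul_one (v a * v b), ← mul_zero (v a * v b), ← mul_ite, ← hq, Finset.mul_sum]
        exact Finset.sum_congr rfl fun i _ => by ring
      simp [this]
    have h1 := sum_hashSketch_sq ω.1 hω (∑ a, v a • q a)
    rw [collisionForm_sum, hy] at h1
    have h2 := abs_quadratic_form_le v fun a b => collisionForm ω.1 ω.2 (q a) (q b)
    have h3 : √(F ω) ≤ 3 / 4 := by
      rw [Real.sqrt_le_left (by norm_num)]; linarith
    have h0 : 0 ≤ ∑ a, v a ^ 2 := Finset.sum_nonneg fun _ _ => sq_nonneg _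
    have h4 := (abs_le.1 (h2.trans (mul_le_mul_of_nonneg_left h3 h0))).1
    have h5 : ∑ t, hashSketch ω.1 ω.2 (∑ a, v a • q a) t ^ 2
        ≤ l1Norm (hashSketch ω.1 ω.2 (∑ a, v a • q a)) ^ 2 := by
      simp_rw [l1Norm, ← sq_abs (hashSketch ω.1 ω.2 (∑ a, v a • q a) _)]
      exact Finset.sum_sq_le_sq_sum_of_nonneg fun t _ => abs_nonneg _
    rw [hy] at hv
    linarith
  have := ENNReal.toReal_mono (measure_ne_top P _) (measure_mono_ae hsub)
  simp only [← measureReal_def] at this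
  have hR : (0 : ℝ) ≤ m ^ 2 * (R : ℝ)⁻¹ := by positivity
  linarith

lemma exists_orthonormal_of_mulVec {n k : ℕ} (U : Matrix (Fin n) (Fin k) ℝ) :
    ∃ m ≤ k, ∃ q : Fin m → Fin n → ℝ, (∀ a b, ∑ i, q a i * q b i = if a = b then 1 else 0) ∧
      ∀ x, ∃ v : Fin m → ℝ, U.mulVec x = ∑ a, v a • q a := by
  let T : (Fin k → ℝ) →ₗ[ℝ] EuclideanSpace ℝ (Fin n) :=
    (WithLp.linearEquiv 2 ℝ (Fin n → ℝ)).symm.toLinearMap ∘ₗ U.mulVecLin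
  obtain ⟨W, hW⟩ : ∃ W, W = T.range := ⟨_, rfl⟩
  have hm : Module.finrank ℝ W ≤ k := by
    rw [hW]; simpa using LinearMap.finrank_range_le T
  have hT : ∀ x, T x ∈ W := fun x => hW ▸ LinearMap.mem_range_self T x
  let b := stdOrthonormalBasis ℝ W
  refine ⟨_, hm, fun a i => (b a : EuclideanSpace ℝ (Fin n)) i, fun a c => ?_, fun x =>
    ⟨fun a => b.repr ⟨T x, hT x⟩ a, ?_⟩⟩
  · have := (orthonormal_iff_ite.1 b.orthonormal) c a
    rw [Submodule.coe_inner, PiLp.inner_apply] at this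
    simpa [eq_comm] using this
  · have h1 := congrArg Subtype.val (b.sum_repr ⟨T x, hT x⟩)
    rw [Submodule.coe_sum] at h1
    ext i
    have h2 := congrArg (fun w : EuclideanSpace ℝ (Fin n) => w i) h1
    simp only [WithLp.ofLp_sum, Finset.sum_apply] at h2 ⊢
    exact h2.symm

/-- Restatement of `countSketch_lower_of_orthonormal` for the column space of `U`, of dimension at
most `k`. -/
lemma countSketch_lower {R n k : ℕ} [NeZero R] (U : Matrix (Fin n) (Fin k) ℝ) :
    ((hashLaw R n).prod (signLaw n)).real
      {ω | ∃ x : Fin k → ℝ, 4 * l1Norm (hashSketch ω.1 ω.2 (U.mulVec x)) ^ 2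
        < ∑ i, U.mulVec x i ^ 2} ≤ 4 * k ^ 2 * (R : ℝ)⁻¹ := by
  obtain ⟨m, hm, q, hq, hx⟩ := exists_orthonormal_of_mulVec U
  refine (measureReal_mono ?_).trans ((countSketch_lower_of_orthonormal q hq).trans ?_)
  · rintro ω ⟨x, hlt⟩
    obtain ⟨v, hv⟩ := hx x
    exact ⟨v, by rwa [hv] at hlt⟩
  · gcongr

/-! ### Existence of well-conditioned bases -/

lemma l1Norm_nonneg {ι : Type*} [Fintype ι] (v : ι → ℝ) : 0 ≤ l1Norm v :=
  Finset.sum_nonneg fun _ _ => abs_nonneg _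

lemma l1Norm_smul {ι : Type*} [Fintype ι] (a : ℝ) (v : ι → ℝ) :
    l1Norm (a • v) = |a| * l1Norm v := by
  simp [l1Norm, abs_mul, Finset.mul_sum]

lemma l1Norm_add_le {ι : Type*} [Fintype ι] (v w : ι → ℝ) :
    l1Norm (v + w) ≤ l1Norm v + l1Norm w := by
  simp only [l1Norm, ← Finset.sum_add_distrib]
  exact Finset.sum_le_sum fun i _ => abs_add_le _ _

lemma continuous_l1Norm {ι : Type*} [Fintype ι] : Continuous (l1Norm : (ι → ℝ) → ℝ) := by
  unfold l1Norm
  fun_prop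

lemma norm_le_l1Norm {ι : Type*} [Fintype ι] (v : ι → ℝ) : ‖v‖ ≤ l1Norm v :=
  (pi_norm_le_iff_of_nonneg (l1Norm_nonneg v)).2 fun i =>
    Finset.single_le_sum (f := fun i => |v i|) (fun _ _ => abs_nonneg _) (Finset.mem_univ i)

lemma entryL1Norm_eq_sum_col {m k : Type*} [Fintype m] [Fintype k] (M : Matrix m k ℝ) :
    entryL1Norm M = ∑ j, l1Norm (M.col j) := by
  rw [entryL1Norm, Finset.sum_comm]; rfl

/-- An Auerbach basis of a space of vectors with the `ℓ₁`-norm: among the families in the unit ball,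
take one which spans the largest volume. -/
lemma exists_auerbach_basis {n : ℕ} (W : Submodule ℝ (Fin n → ℝ)) :
    ∃ v : Module.Basis (Fin (Module.finrank ℝ W)) ℝ W,
      (∀ j, l1Norm (v j : Fin n → ℝ) ≤ 1) ∧
      ∀ (y : W) j, |v.repr y j| ≤ l1Norm (y : Fin n → ℝ) := by
  obtain ⟨k, hk⟩ : ∃ k, k = Module.finrank ℝ W := ⟨_, rfl⟩
  rw [← hk]
  let b : Module.Basis (Fin k) ℝ W := Module.finBasisOfFinrankEq ℝ W hk.symm
  let K : Set (Fin k → W) := {v | ∀ j, l1Norm (v j : Fin n → ℝ) ≤ 1}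
  have hKclosed : IsClosed K := by
    simp only [K, Set.ofPred_forall]
    exact isClosed_iInter fun j => isClosed_le
      (continuous_l1Norm.comp (continuous_subtype_val.comp (continuous_apply j))) continuous_const
  have hK : IsCompact K := by
    refine Metric.isCompact_of_isClosed_isBounded hKclosed
      ((Metric.isBounded_closedBall (x := 0) (r := 1)).subset fun v hv => ?_)
    rw [mem_closedBall_zero_iff, pi_norm_le_iff_of_nonneg zero_le_one]
    exact fun j => (norm_le_l1Norm _).trans (hv j)
  have hcont : Continuous fun v : Fin k → W => |b.det v| := by
    simp_rw [b.det_apply]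
    refine (Continuous.matrix_det (continuous_matrix fun i j => ?_)).abs
    exact (b.coord i).continuous_of_finiteDimensional.comp (continuous_apply j)
  obtain ⟨v, hvK, hmax⟩ := hK.exists_isMaxOn ⟨0, fun j => by simp [l1Norm]⟩ hcont.continuousOn
  have hmax : ∀ w ∈ K, |b.det w| ≤ |b.det v| := hmax
  have hscale : ∀ w : W, ∃ r : ℝ, r ≠ 0 ∧ l1Norm ((r • w : W) : Fin n → ℝ) ≤ 1 := by
    intro w
    have h0 := l1Norm_nonneg (w : Fin n → ℝ)
    refine ⟨(l1Norm (w : Fin n → ℝ) + 1)⁻¹, by positivity, ?_⟩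
    rw [Submodule.coe_smul, l1Norm_smul, abs_of_nonneg (by positivity), inv_mul_le_one₀ (by positivity)]
    linarith
  have hdet : b.det v ≠ 0 := by
    choose r hr hr1 using fun j => hscale (b j)
    have := hmax (fun j => r j • b j) hr1
    rw [AlternatingMap.map_smul_univ, b.det_self] at this
    have hp : ∏ j, r j ≠ 0 := Finset.prod_ne_zero_iff.2 fun j _ => hr j
    have : 0 < |b.det v| := lt_of_lt_of_le (by simpa using hp) this
    exact abs_pos.1 this
  obtain ⟨hli, hsp⟩ := (b.is_basis_iff_det (v := v)).2 (isUnit_iff_ne_zero.2 hdet)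
  let B := Module.Basis.mk hli hsp.ge
  refine ⟨B, fun j => by simpa [B] using hvK j, fun y j => ?_⟩
  -- By Cramer's rule a large coordinate would allow replacing `v j` by a normalised `y` and so
  -- increase the volume.
  have hy : b.det (Function.update v j y) = B.repr y j * b.det v := by
    have h1 : y = ∑ l, B.repr y l • v l := by
      conv_lhs => rw [← B.sum_repr y]
      simp [B]
    let f := b.det.toMultilinearMap.toLinearMap v j
    have hf : ∀ w, f w = b.det (Function.update v j w) := fun w => rfl
    rw [← hf]
    conv_lhs => rw [h1]
    rw [map_sum, Finset.sum_eq_single j]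
    · rw [map_smul, hf, Function.update_eq_self, smul_eq_mul]
    · intro l _ hl
      rw [map_smul, hf, AlternatingMap.map_update_self _ _ hl.symm, smul_zero]
    · simp
  have hle : |b.det (Function.update v j y)| ≤ l1Norm (y : Fin n → ℝ) * |b.det v| := by
    rcases (l1Norm_nonneg (y : Fin n → ℝ)).eq_or_lt with h0 | h0
    · have : y = 0 := by
        have := norm_le_l1Norm (y : Fin n → ℝ)
        rw [← h0] at this
        exact Subtype.ext (norm_le_zero_iff.1 this)
      rw [this, AlternatingMap.map_update_zero]
      simp [l1Norm]
    · have := hmax (Function.update v j ((l1Norm (y : Fin n → ℝ))⁻¹ • y)) (by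
        intro l
        by_cases hl : l = j
        · subst hl
          rw [Function.update_self, Submodule.coe_smul, l1Norm_smul, abs_of_pos (by positivity),
            inv_mul_cancel₀ h0.ne']
        · rw [Function.update_of_ne hl]; exact hvK l)
      rw [AlternatingMap.map_update_smul, smul_eq_mul, abs_mul, abs_of_pos (by positivity),
        inv_mul_le_iff₀ h0] at this
      exact this
  rw [hy, abs_mul] at hle
  exact le_of_mul_le_mul_right hle (abs_pos.2 hdet)

lemma exists_wellConditioned_basisMatrix {n d : ℕ} (A : Matrix (Fin n) (Fin d) ℝ) :
    ∃ (k : ℕ) (U : Matrix (Fin n) (Fin k) ℝ), IsBasisMatrix U A ∧ IsWellConditioned d 1 U := by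
  let W := Submodule.span ℝ (Set.range A.col)
  obtain ⟨v, hv1, hv2⟩ := exists_auerbach_basis W
  have hk : Module.finrank ℝ W ≤ d :=
    (finrank_range_le_card (R := ℝ) A.col).trans_eq (Fintype.card_fin d)
  let U : Matrix (Fin n) (Fin (Module.finrank ℝ W)) ℝ := Matrix.of fun i j => (v j : Fin n → ℝ) i
  have hcol : U.col = fun j => (v j : Fin n → ℝ) := rfl
  refine ⟨_, U, ⟨?_, ?_⟩, ?_, fun x => ?_⟩
  · rw [hcol]
    exact v.linearIndependent.map' W.subtype W.ker_subtype
  · rw [hcol]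
    have := congrArg (Submodule.map W.subtype) v.span_eq
    rw [Submodule.map_span, ← Set.range_comp, Submodule.map_top, Submodule.range_subtype] at this
    exact this
  · rw [entryL1Norm_eq_sum_col]
    refine (Finset.sum_le_sum fun j _ => hv1 j).trans ?_
    simpa using hk
  · have hx : U.mulVec x = ((∑ j, x j • v j : W) : Fin n → ℝ) := by
      ext i
      simp [U, Matrix.mulVec, dotProduct, mul_comm]
    rw [one_mul, pi_norm_le_iff_of_nonneg (l1Norm_nonneg _)]
    intro j
    have := hv2 (∑ j, x j • v j) j
    rw [v.repr_sum_self] at this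
    rw [hx]; exact this

lemma IsBasisMatrix.le {n d k : ℕ} {U : Matrix (Fin n) (Fin k) ℝ} {A : Matrix (Fin n) (Fin d) ℝ}
    (h : IsBasisMatrix U A) : k ≤ d := by
  have h1 := finrank_span_eq_card h.1
  rw [h.2, Fintype.card_fin] at h1
  rw [← h1]
  exact (finrank_range_le_card (R := ℝ) A.col).trans_eq (Fintype.card_fin d)

lemma IsBasisMatrix.exists_mulVec_eq {n d k : ℕ} {U : Matrix (Fin n) (Fin k) ℝ}
    {A : Matrix (Fin n) (Fin d) ℝ} (h : IsBasisMatrix U A) (x : Fin d → ℝ) :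
    ∃ z : Fin k → ℝ, A.mulVec x = U.mulVec z := by
  have : A.mulVec x ∈ Submodule.span ℝ (Set.range U.col) := by
    rw [h.2, ← Matrix.range_mulVecLin]
    exact ⟨x, rfl⟩
  rw [← Matrix.range_mulVecLin] at this
  obtain ⟨z, hz⟩ := this
  exact ⟨z, hz.symm⟩

/-! ### From finitely many vectors to the whole subspace -/

lemma l1Norm_mulVec_le {m k : Type*} [Fintype m] [Fintype k] (M : Matrix m k ℝ) (z : k → ℝ) :
    l1Norm (M.mulVec z) ≤ ‖z‖ * entryL1Norm M := by
  rw [l1Norm, entryL1Norm, Finset.mul_sum]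
  refine Finset.sum_le_sum fun i _ => ?_
  rw [Finset.mul_sum]
  refine (Finset.abs_sum_le_sum_abs _ _).trans (Finset.sum_le_sum fun j _ => ?_)
  rw [abs_mul, mul_comm]
  exact mul_le_mul_of_nonneg_right (norm_le_pi_norm z j) (abs_nonneg _)

/-- The grid point with index `g` of the grid of mesh `1 / N` in the cube `[-1, 1]^k`. -/
def gridPoint {k : ℕ} (N : ℕ) (g : Fin k → Fin (2 * N + 1)) : Fin k → ℝ :=
  fun j => ((g j : ℕ) - N : ℝ) / N

lemma exists_gridPoint_near {k N : ℕ} (hN : 0 < N) (x : Fin k → ℝ) (hx : ‖x‖ ≤ 1) :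
    ∃ g : Fin k → Fin (2 * N + 1), ‖x - gridPoint N g‖ ≤ (N : ℝ)⁻¹ := by
  have hN' : (0 : ℝ) < N := by exact_mod_cast hN
  have h : ∀ t : ℝ, |t| ≤ 1 → ∃ m : Fin (2 * N + 1), |t - ((m : ℕ) - N : ℝ) / N| ≤ (N : ℝ)⁻¹ := by
    intro t ht
    obtain ⟨h1, h2⟩ := abs_le.1 ht
    have h0 : 0 ≤ (t + 1) * N := mul_nonneg (by linarith) hN'.le
    have hlt : ⌊(t + 1) * N⌋₊ < 2 * N + 1 := by
      rw [Nat.lt_succ_iff]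
      refine Nat.floor_le_of_le ?_
      push_cast
      exact mul_le_mul_of_nonneg_right (by linarith) hN'.le
    refine ⟨⟨_, hlt⟩, ?_⟩
    have h3 := Nat.floor_le h0
    have h4 := Nat.lt_floor_add_one ((t + 1) * N)
    have h5 : t - ((⌊(t + 1) * N⌋₊ : ℝ) - N) / N = ((t + 1) * N - ⌊(t + 1) * N⌋₊) * (N : ℝ)⁻¹ := by
      field_simp; ring
    simp only
    rw [h5, abs_mul, abs_of_pos (inv_pos.2 hN')]
    refine mul_le_of_le_one_left (inv_pos.2 hN').le ?_
    rw [abs_le]; constructor <;> linarith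
  choose g hg using fun j => h (x j) ((norm_le_pi_norm x j).trans hx)
  exact ⟨g, (pi_norm_le_iff_of_nonneg (inv_pos.2 hN').le).2 hg⟩

/-- A vector of small Euclidean norm loses little `ℓ₁`-mass when its entries are capped at `τ`. -/
lemma le_sum_min_of_sq_le {ι : Type*} [Fintype ι] (y : ι → ℝ) {τ : ℝ} (hτ : 0 < τ) :
    l1Norm y - (∑ i, y i ^ 2) / τ ≤ ∑ i, min |y i| τ := by
  rw [l1Norm, Finset.sum_div, ← Finset.sum_sub_distrib]
  refine Finset.sum_le_sum fun i _ => ?_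
  rw [← sq_abs]
  have h0 := abs_nonneg (y i)
  refine le_min (sub_le_self _ (by positivity)) ?_
  rw [sub_le_iff_le_add, ← sub_le_iff_le_add', le_div_iff₀ hτ]
  nlinarith [sq_nonneg (|y i| - τ)]

lemma sum_min_sub_le {ι : Type*} [Fintype ι] (y z : ι → ℝ) (τ : ℝ) :
    ∑ i, min |y i| τ - l1Norm (y - z) ≤ ∑ i, min |z i| τ := by
  rw [l1Norm, ← Finset.sum_sub_distrib]
  refine Finset.sum_le_sum fun i _ => ?_
  have h1 : |y i| ≤ |z i| + |y i - z i| := by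
    have := abs_add_le (z i) (y i - z i)
    rwa [add_sub_cancel] at this
  have h0 := abs_nonneg (y i - z i)
  rw [Pi.sub_apply, sub_le_iff_le_add, ← min_add_add_right]
  exact min_le_min h1 (by linarith)

/-- The lower bound for one vector `U x` of unit norm: if its Euclidean norm is at least `2⁻⁷ / d`,
the CountSketch provides it; otherwise the vector is flat and the sparse Cauchy sketch does, since it
does so at a nearby grid point. -/
lemma lower_of_unit {n k r₁ r₂ d : ℕ} (hd : 2 ≤ d) {U : Matrix (Fin n) (Fin k) ℝ}
    (hU1 : entryL1Norm U ≤ d) (hU2 : ∀ x, ‖x‖ ≤ l1Norm (U.mulVec x))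
    (S₁ : Matrix (Fin r₁) (Fin n) ℝ) (S₂ : Matrix (Fin r₂) (Fin n) ℝ)
    (H1 : ∀ x, ∑ i, U.mulVec x i ^ 2 ≤ 4 * l1Norm (S₁.mulVec (U.mulVec x)) ^ 2)
    (H2 : entryL1Norm (S₂ * U) ≤ 2 ^ 16 * (d * Real.log d))
    (H3 : ∀ g : Fin k → Fin (2 * (2 ^ 23 * d) + 1),
      1 / 4 ≤ ∑ i, min |U.mulVec (gridPoint (2 ^ 23 * d) g) i| (2 ^ 12 * (d : ℝ) ^ 2)⁻¹ →
      Real.log d / 64 ≤ l1Norm (S₂.mulVec (U.mulVec (gridPoint (2 ^ 23 * d) g))))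
    (x : Fin k → ℝ) (hx : l1Norm (U.mulVec x) = 1) :
    (2 ^ 8)⁻¹ * Real.log d ≤ d * Real.log d * l1Norm (S₁.mulVec (U.mulVec x))
      + l1Norm (S₂.mulVec (U.mulVec x)) := by
  have hd' : (2 : ℝ) ≤ d := by exact_mod_cast hd
  have hlog : 0 < Real.log d := Real.log_pos (by linarith)
  have hS1 := l1Norm_nonneg (S₁.mulVec (U.mulVec x))
  have hS2 := l1Norm_nonneg (S₂.mulVec (U.mulVec x))
  rcases le_total ((2 ^ 7 * (d : ℝ))⁻¹ ^ 2) (∑ i, U.mulVec x i ^ 2) with hcase | hcase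
  · have h1 : (2 ^ 7 * (d : ℝ))⁻¹ ≤ 2 * l1Norm (S₁.mulVec (U.mulVec x)) := by
      refine (pow_le_pow_iff_left₀ (by positivity) (by positivity) two_ne_zero).1 ?_
      rw [mul_pow]
      refine hcase.trans ((H1 x).trans (by norm_num))
    have h2 : d * Real.log d * (2 ^ 7 * (d : ℝ))⁻¹
        ≤ d * Real.log d * (2 * l1Norm (S₁.mulVec (U.mulVec x))) := by gcongr
    have h3 : d * Real.log d * (2 ^ 7 * (d : ℝ))⁻¹ = (2 ^ 7)⁻¹ * Real.log d := by field_simp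
    rw [h3] at h2
    linarith
  · have hτ : (0 : ℝ) < (2 ^ 12 * (d : ℝ) ^ 2)⁻¹ := by positivity
    have h1 := le_sum_min_of_sq_le (U.mulVec x) hτ
    have h2 : (∑ i, U.mulVec x i ^ 2) / (2 ^ 12 * (d : ℝ) ^ 2)⁻¹ ≤ 1 / 4 := by
      rw [div_inv_eq_mul]
      calc (∑ i, U.mulVec x i ^ 2) * (2 ^ 12 * (d : ℝ) ^ 2)
          ≤ (2 ^ 7 * (d : ℝ))⁻¹ ^ 2 * (2 ^ 12 * (d : ℝ) ^ 2) := by gcongr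
        _ = 1 / 4 := by field_simp; norm_num
    rw [hx] at h1
    obtain ⟨g, hg⟩ := exists_gridPoint_near (N := 2 ^ 23 * d) (by positivity) x
      ((hU2 x).trans hx.le)
    set x' := gridPoint (2 ^ 23 * d) g
    have hU0 : 0 ≤ entryL1Norm U :=
      Finset.sum_nonneg fun _ _ => Finset.sum_nonneg fun _ _ => abs_nonneg _
    have hSU0 : 0 ≤ entryL1Norm (S₂ * U) :=
      Finset.sum_nonneg fun _ _ => Finset.sum_nonneg fun _ _ => abs_nonneg _
    rw [Nat.cast_mul, Nat.cast_pow, Nat.cast_ofNat] at hg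
    have h3 : l1Norm (U.mulVec x - U.mulVec x') ≤ 1 / 2 := by
      rw [← Matrix.mulVec_sub]
      calc l1Norm (U.mulVec (x - x')) ≤ ‖x - x'‖ * entryL1Norm U := l1Norm_mulVec_le _ _
        _ ≤ (2 ^ 23 * (d : ℝ))⁻¹ * d := by gcongr
        _ = (2 ^ 23)⁻¹ := by field_simp
        _ ≤ 1 / 2 := by norm_num
    have h4 := sum_min_sub_le (U.mulVec x) (U.mulVec x') (2 ^ 12 * (d : ℝ) ^ 2)⁻¹
    have h5 := H3 g (by linarith)
    have h6 : l1Norm (S₂.mulVec (U.mulVec (x' - x))) ≤ Real.log d / 128 := by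
      rw [Matrix.mulVec_mulVec]
      calc l1Norm ((S₂ * U).mulVec (x' - x)) ≤ ‖x' - x‖ * entryL1Norm (S₂ * U) :=
            l1Norm_mulVec_le _ _
        _ ≤ (2 ^ 23 * (d : ℝ))⁻¹ * (2 ^ 16 * (d * Real.log d)) := by
            rw [norm_sub_rev]; gcongr
        _ = Real.log d / 128 := by field_simp; norm_num
    have h7 := l1Norm_add_le (S₂.mulVec (U.mulVec x)) (S₂.mulVec (U.mulVec (x' - x)))
    rw [← Matrix.mulVec_add, ← Matrix.mulVec_add, add_sub_cancel] at h7
    have h8 : 0 ≤ d * Real.log d * l1Norm (S₁.mulVec (U.mulVec x)) := by positivity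
    linarith

/-- The deterministic part of the argument: the bounds for all `x` follow from the non-expansion of
the CountSketch, its Euclidean lower bound, the bound on the images of the columns of `U`, and the
lower bound at the flat grid points. -/
lemma bounds_of_good {n k r₁ r₂ d : ℕ} (hd : 2 ≤ d) {U : Matrix (Fin n) (Fin k) ℝ}
    (hU1 : entryL1Norm U ≤ d) (hU2 : ∀ x, ‖x‖ ≤ l1Norm (U.mulVec x))
    (S₁ : Matrix (Fin r₁) (Fin n) ℝ) (S₂ : Matrix (Fin r₂) (Fin n) ℝ)
    (H0 : ∀ y, l1Norm (S₁.mulVec y) ≤ l1Norm y)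
    (H1 : ∀ x, ∑ i, U.mulVec x i ^ 2 ≤ 4 * l1Norm (S₁.mulVec (U.mulVec x)) ^ 2)
    (H2 : entryL1Norm (S₂ * U) ≤ 2 ^ 16 * (d * Real.log d))
    (H3 : ∀ g : Fin k → Fin (2 * (2 ^ 23 * d) + 1),
      1 / 4 ≤ ∑ i, min |U.mulVec (gridPoint (2 ^ 23 * d) g) i| (2 ^ 12 * (d : ℝ) ^ 2)⁻¹ →
      Real.log d / 64 ≤ l1Norm (S₂.mulVec (U.mulVec (gridPoint (2 ^ 23 * d) g))))
    (x : Fin k → ℝ) :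
    (2 ^ 8)⁻¹ * Real.log d * l1Norm (U.mulVec x)
        ≤ d * Real.log d * l1Norm (S₁.mulVec (U.mulVec x)) + l1Norm (S₂.mulVec (U.mulVec x)) ∧
      d * Real.log d * l1Norm (S₁.mulVec (U.mulVec x)) + l1Norm (S₂.mulVec (U.mulVec x))
        ≤ (1 + 2 ^ 16) * (d * Real.log d) * l1Norm (U.mulVec x) := by
  have hd' : (2 : ℝ) ≤ d := by exact_mod_cast hd
  have hlog : 0 < Real.log d := Real.log_pos (by linarith)
  have hL := l1Norm_nonneg (U.mulVec x)
  constructor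
  · rcases hL.eq_or_lt with h0 | h0
    · rw [← h0, mul_zero]
      have hS1 := l1Norm_nonneg (S₁.mulVec (U.mulVec x))
      have hS2 := l1Norm_nonneg (S₂.mulVec (U.mulVec x))
      positivity
    · have hs := fun {r : ℕ} (S : Matrix (Fin r) (Fin n) ℝ) =>
        show l1Norm (S.mulVec (U.mulVec ((l1Norm (U.mulVec x))⁻¹ • x)))
          = (l1Norm (U.mulVec x))⁻¹ * l1Norm (S.mulVec (U.mulVec x)) by
        rw [Matrix.mulVec_smul, Matrix.mulVec_smul, l1Norm_smul, abs_of_pos (by positivity)]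
      have := lower_of_unit hd hU1 hU2 S₁ S₂ H1 H2 H3 ((l1Norm (U.mulVec x))⁻¹ • x) (by
        rw [Matrix.mulVec_smul, l1Norm_smul, abs_of_pos (by positivity), inv_mul_cancel₀ h0.ne'])
      rw [hs, hs] at this
      calc (2 ^ 8)⁻¹ * Real.log d * l1Norm (U.mulVec x)
          ≤ (d * Real.log d * ((l1Norm (U.mulVec x))⁻¹ * l1Norm (S₁.mulVec (U.mulVec x)))
            + (l1Norm (U.mulVec x))⁻¹ * l1Norm (S₂.mulVec (U.mulVec x))) * l1Norm (U.mulVec x) := by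
            gcongr
        _ = _ := by field_simp
  · have h1 : l1Norm (S₂.mulVec (U.mulVec x)) ≤ l1Norm (U.mulVec x) * (2 ^ 16 * (d * Real.log d)) := by
      rw [Matrix.mulVec_mulVec]
      refine (l1Norm_mulVec_le _ _).trans ?_
      have hSU0 : 0 ≤ entryL1Norm (S₂ * U) :=
        Finset.sum_nonneg fun _ _ => Finset.sum_nonneg fun _ _ => abs_nonneg _
      gcongr
      exact hU2 x
    have h2 : d * Real.log d * l1Norm (S₁.mulVec (U.mulVec x))
        ≤ d * Real.log d * l1Norm (U.mulVec x) := by gcongr; exact H0 _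
    linarith

/-! ### Probabilities of the exceptional events -/

/-- The number of rows of each of the two parts of the embedding. -/
abbrev rows (d : ℕ) : ℕ := 2 ^ 12 * d ^ 2

/-- The bound of `cauchySketch_upper`, averaged over the hash function. -/
lemma cauchySketch_upper_real {R n k : ℕ} [NeZero R] (U : Matrix (Fin n) (Fin k) ℝ)
    {M A : ℝ} (hM : 0 < M) (hA : 0 < A) :
    ((hashLaw R n).prod (cauchyLaw n)).real
      {ω | A < entryL1Norm (hashMatrix ω.1 * Matrix.diagonal ω.2 * U)}
      ≤ R * k * M⁻¹ + entryL1Norm U * truncMean M / A := by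
  have hcol : ∀ (h : Fin n → Fin R) c, entryL1Norm (hashMatrix h * Matrix.diagonal c * U)
      = ∑ j, l1Norm (hashSketch h c (U.col j)) := by
    intro h c
    rw [entryL1Norm_eq_sum_col]
    rfl
  simp_rw [hcol]
  have hmeas : MeasurableSet {ω : (Fin n → Fin R) × (Fin n → ℝ) |
      A < ∑ j, l1Norm (hashSketch ω.1 ω.2 (U.col j))} := by
    refine measurableSet_lt measurable_const (Finset.measurable_sum _ fun j _ => ?_)
    exact Finset.measurable_sum _ fun t _ => (measurable_hashSketch _ t).abs
  have hb := fun h : Fin n → Fin R => cauchySketch_upper h U hM hA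
  have hb0 : 0 ≤ R * k * M⁻¹ + entryL1Norm U * truncMean M / A := by
    have : Nonempty (Fin n → Fin R) := ⟨fun _ => 0⟩
    exact measureReal_nonneg.trans (hb this.some)
  rw [measureReal_def]
  refine ENNReal.toReal_le_of_le_ofReal hb0 ?_
  rw [Measure.prod_apply hmeas]
  refine (lintegral_mono (g := fun _ => ENNReal.ofReal
    (R * k * M⁻¹ + entryL1Norm U * truncMean M / A)) fun h => ?_).trans (by simp)
  rw [ENNReal.le_ofReal_iff_toReal_le (measure_ne_top _ _) hb0]
  exact hb h

lemma cauchy_upper_prob {n k d : ℕ} (hd : 2 ≤ d) (hk : k ≤ d) [NeZero (rows d)]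
    {U : Matrix (Fin n) (Fin k) ℝ} (hU : entryL1Norm U ≤ d) :
    ((hashLaw (rows d) n).prod (cauchyLaw n)).real
      {ω | 2 ^ 16 * (d * Real.log d) < entryL1Norm (hashMatrix ω.1 * Matrix.diagonal ω.2 * U)}
      ≤ 2 * (2 ^ 10)⁻¹ := by
  have hd' : (2 : ℝ) ≤ d := by exact_mod_cast hd
  have hk' : (k : ℝ) ≤ d := by exact_mod_cast hk
  have hlog : 0 < Real.log d := Real.log_pos (by linarith)
  have hM1 : (4 : ℝ) ≤ 2 ^ 22 * (d : ℝ) ^ 3 := by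
    have : (1 : ℝ) ≤ (d : ℝ) ^ 3 := one_le_pow₀ (by linarith)
    linarith
  -- The truncation level is `2 ^ 10` times the number `rows d * d` of linear forms.
  refine (cauchySketch_upper_real U (M := 2 ^ 22 * (d : ℝ) ^ 3) (by positivity)
    (by positivity)).trans ?_
  have h1 : truncMean (2 ^ 22 * (d : ℝ) ^ 3) ≤ 50 * Real.log d := by
    refine (truncMean_le hM1).trans ?_
    have : Real.log (2 ^ 22 * (d : ℝ) ^ 3) ≤ Real.log ((d : ℝ) ^ 25) := by
      refine Real.log_le_log (by positivity) ?_
      calc (2 : ℝ) ^ 22 * (d : ℝ) ^ 3 ≤ (d : ℝ) ^ 22 * (d : ℝ) ^ 3 := by gcongr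
        _ = (d : ℝ) ^ 25 := by ring
    rw [Real.log_pow] at this
    push_cast at this
    linarith
  have h2 : ((rows d : ℕ) : ℝ) * k * (2 ^ 22 * (d : ℝ) ^ 3)⁻¹ ≤ (2 ^ 10)⁻¹ := by
    calc ((rows d : ℕ) : ℝ) * k * (2 ^ 22 * (d : ℝ) ^ 3)⁻¹
        ≤ ((rows d : ℕ) : ℝ) * d * (2 ^ 22 * (d : ℝ) ^ 3)⁻¹ := by gcongr
      _ = (2 ^ 10)⁻¹ := by push_cast [rows]; field_simp; norm_num
  have hU0 : 0 ≤ entryL1Norm U :=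
    Finset.sum_nonneg fun _ _ => Finset.sum_nonneg fun _ _ => abs_nonneg _
  have h3 : entryL1Norm U * truncMean (2 ^ 22 * (d : ℝ) ^ 3) / (2 ^ 16 * (d * Real.log d))
      ≤ (2 ^ 10)⁻¹ := by
    have h4 := truncMean_nonneg (B := 2 ^ 22 * (d : ℝ) ^ 3) (by positivity)
    calc entryL1Norm U * truncMean (2 ^ 22 * (d : ℝ) ^ 3) / (2 ^ 16 * (d * Real.log d))
        ≤ d * (50 * Real.log d) / (2 ^ 16 * (d * Real.log d)) := by gcongr
      _ = 50 / 2 ^ 16 := by field_simp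
      _ ≤ _ := by norm_num
  linarith

lemma cauchy_grid_prob {n k d : ℕ} (hd : 2 ≤ d) (hk : k ≤ d) [NeZero (rows d)]
    (U : Matrix (Fin n) (Fin k) ℝ) :
    ((hashLaw (rows d) n).prod (cauchyLaw n)).real
      {ω | ∃ g : Fin k → Fin (2 * (2 ^ 23 * d) + 1),
        1 / 4 ≤ ∑ i, min |U.mulVec (gridPoint (2 ^ 23 * d) g) i| (2 ^ 12 * (d : ℝ) ^ 2)⁻¹ ∧
        l1Norm (hashSketch ω.1 ω.2 (U.mulVec (gridPoint (2 ^ 23 * d) g))) < Real.log d / 64}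
      ≤ (2 ^ 10)⁻¹ := by
  have hd' : (2 : ℝ) ≤ d := by exact_mod_cast hd
  have hk' : (k : ℝ) ≤ d := by exact_mod_cast hk
  have hlog : 0 < Real.log d := Real.log_pos (by linarith)
  set P := (hashLaw (rows d) n).prod (cauchyLaw n)
  have hone : ∀ g : Fin k → Fin (2 * (2 ^ 23 * d) + 1),
      P.real {ω | 1 / 4 ≤ ∑ i, min |U.mulVec (gridPoint (2 ^ 23 * d) g) i|
          (2 ^ 12 * (d : ℝ) ^ 2)⁻¹ ∧
        l1Norm (hashSketch ω.1 ω.2 (U.mulVec (gridPoint (2 ^ 23 * d) g))) < Real.log d / 64}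
      ≤ rexp (-(64 * (d * Real.log d))) := by
    intro g
    by_cases hg : 1 / 4 ≤ ∑ i, min |U.mulVec (gridPoint (2 ^ 23 * d) g) i|
        (2 ^ 12 * (d : ℝ) ^ 2)⁻¹
    -- With `B = d` and `τ = 1 / (2 ^ 12 * d ^ 2)`, the choice `s = 2 ^ 12 * d` makes `s * τ * B = 1`.
    · refine (measureReal_mono (fun ω hω => le_of_lt hω.2)).trans
        ((cauchySketch_lower (R := rows d) (U.mulVec (gridPoint (2 ^ 23 * d) g))
          (s := 2 ^ 12 * d) (B := d) (Real.log d / 64) (by positivity) (by positivity)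
          (by positivity) (le_of_eq (by field_simp)) (by norm_num) hg
          (by push_cast [rows]; nlinarith)).trans ?_)
      refine Real.exp_le_exp.2 ?_
      have h1 := log_le_two_mul_truncMean (B := d) (by linarith)
      have h2 : (2 ^ 12 * (d : ℝ)) * Real.log d ≤ (2 ^ 12 * (d : ℝ)) * (2 * truncMean d) := by gcongr
      linarith
    · refine le_trans (le_of_eq ?_) (Real.exp_pos _).le
      convert! measureReal_empty (μ := P)
      exact Set.eq_empty_of_forall_notMem fun ω hω => hg hω.1
  have hset : {ω : (Fin n → Fin (rows d)) × (Fin n → ℝ) |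
      ∃ g : Fin k → Fin (2 * (2 ^ 23 * d) + 1),
        1 / 4 ≤ ∑ i, min |U.mulVec (gridPoint (2 ^ 23 * d) g) i| (2 ^ 12 * (d : ℝ) ^ 2)⁻¹ ∧
        l1Norm (hashSketch ω.1 ω.2 (U.mulVec (gridPoint (2 ^ 23 * d) g))) < Real.log d / 64}
      = ⋃ g : Fin k → Fin (2 * (2 ^ 23 * d) + 1),
        {ω | 1 / 4 ≤ ∑ i, min |U.mulVec (gridPoint (2 ^ 23 * d) g) i| (2 ^ 12 * (d : ℝ) ^ 2)⁻¹ ∧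
          l1Norm (hashSketch ω.1 ω.2 (U.mulVec (gridPoint (2 ^ 23 * d) g)))
            < Real.log d / 64} := by
    ext ω; simp
  rw [hset]
  refine (measureReal_iUnion_fintype_le _).trans ((Finset.sum_le_sum fun g _ => hone g).trans ?_)
  rw [Finset.sum_const, Finset.card_univ, Fintype.card_fun, Fintype.card_fin, Fintype.card_fin,
    nsmul_eq_mul]
  -- The number of grid points is smaller than the inverse of the failure probability.
  have hN : (((2 * (2 ^ 23 * d) + 1) ^ k : ℕ) : ℝ) ≤ rexp (26 * (d * Real.log d)) := by
    have h1 : ((2 * (2 ^ 23 * d) + 1 : ℕ) : ℝ) ≤ (d : ℝ) ^ 26 := by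
      calc ((2 * (2 ^ 23 * d) + 1 : ℕ) : ℝ) ≤ 2 ^ 25 * (d : ℝ) := by push_cast; linarith
        _ ≤ (d : ℝ) ^ 25 * d := by gcongr
        _ = (d : ℝ) ^ 26 := by ring
    have h2 : (d : ℝ) ^ 26 = rexp (26 * Real.log d) := by
      rw [show (26 : ℝ) * Real.log d = (26 : ℕ) * Real.log d by norm_num, Real.exp_nat_mul,
        Real.exp_log (by linarith)]
    calc (((2 * (2 ^ 23 * d) + 1) ^ k : ℕ) : ℝ) = ((2 * (2 ^ 23 * d) + 1 : ℕ) : ℝ) ^ k := by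
          push_cast; rfl
      _ ≤ ((d : ℝ) ^ 26) ^ k := by gcongr
      _ ≤ ((d : ℝ) ^ 26) ^ d := by
          gcongr
          exact one_le_pow₀ (by linarith)
      _ = _ := by rw [h2, ← Real.exp_nat_mul]; congr 1; ring
  calc _ ≤ rexp (26 * (d * Real.log d)) * rexp (-(64 * (d * Real.log d))) := by gcongr
    _ = rexp (-(38 * (d * Real.log d))) := by rw [← Real.exp_add]; congr 1; ring
    _ ≤ rexp (-(10 * Real.log 2)) := by
        have h1 : Real.log 2 ≤ Real.log d := Real.log_le_log (by norm_num) hd'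
        have h2 : 0 < Real.log 2 := Real.log_pos (by norm_num)
        have h3 : 2 * Real.log 2 ≤ d * Real.log d := by gcongr
        exact Real.exp_le_exp.2 (by linarith)
    _ = (2 ^ 10)⁻¹ := by
        rw [Real.exp_neg]
        congr 1
        have := Real.exp_nat_mul (Real.log 2) 10
        rw [Real.exp_log (by norm_num)] at this
        exact_mod_cast this

/-! ### The stacked sketch -/

lemma measurable_entry {m k : Type*} (i : m) (j : k) :
    Measurable fun S : Matrix m k ℝ => S i j :=
  (measurable_pi_apply j).comp (measurable_pi_apply i)

lemma measurable_hashMatrix_mul_diagonal {R n : ℕ} :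
    Measurable fun ω : (Fin n → Fin R) × (Fin n → ℝ) =>
      hashMatrix ω.1 * Matrix.diagonal ω.2 := by
  refine measurable_pi_iff.2 fun t => measurable_pi_iff.2 fun i => ?_
  refine measurable_from_prod_countable_right fun h => ?_
  simp only [Matrix.mul_diagonal]
  fun_prop

/-- The stacked sketch as a function of the hash functions, the signs and the Cauchy variables. -/
def stackedSketch {R₁ R₂ n : ℕ} (s : ℝ)
    (ω : ((Fin n → Fin R₁) × (Fin n → ℝ)) × ((Fin n → Fin R₂) × (Fin n → ℝ))) :
    Matrix (Fin R₁ ⊕ Fin R₂) (Fin n) ℝ :=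
  Matrix.fromRows (s • (hashMatrix ω.1.1 * Matrix.diagonal ω.1.2))
    (hashMatrix ω.2.1 * Matrix.diagonal ω.2.2)

lemma measurable_fromRows {R₁ R₂ n : ℕ} (s : ℝ) :
    Measurable fun S : Matrix (Fin R₁) (Fin n) ℝ × Matrix (Fin R₂) (Fin n) ℝ =>
      Matrix.fromRows (s • S.1) S.2 := by
  refine measurable_pi_iff.2 fun t => measurable_pi_iff.2 fun i => ?_
  rcases t with t | t
  · exact ((measurable_entry t i).comp measurable_fst).const_mul s
  · exact (measurable_entry t i).comp measurable_snd

lemma measurable_stackedSketch {R₁ R₂ n : ℕ} (s : ℝ) :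
    Measurable (stackedSketch (R₁ := R₁) (R₂ := R₂) (n := n) s) :=
  (measurable_fromRows s).comp
    (measurable_hashMatrix_mul_diagonal.prodMap measurable_hashMatrix_mul_diagonal)

/-- The joint law of the hash functions, the signs and the Cauchy variables. -/
abbrev sourceLaw (R₁ R₂ n : ℕ) :
    Measure (((Fin n → Fin R₁) × (Fin n → ℝ)) × ((Fin n → Fin R₂) × (Fin n → ℝ))) :=
  ((hashLaw R₁ n).prod (signLaw n)).prod ((hashLaw R₂ n).prod (cauchyLaw n))

lemma stackedSketchLaw_eq_map (s : ℝ) (R₁ R₂ n : ℕ) [NeZero R₁] [NeZero R₂] :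
    stackedSketchLaw s R₁ R₂ n = (sourceLaw R₁ R₂ n).map (stackedSketch s) := by
  unfold stackedSketchLaw countSketchLaw sparseCauchyLaw hashSketchLaw
  rw [Measure.map_prod_map _ _ measurable_hashMatrix_mul_diagonal
    measurable_hashMatrix_mul_diagonal, Measure.map_map (measurable_fromRows s)
      (measurable_hashMatrix_mul_diagonal.prodMap measurable_hashMatrix_mul_diagonal)]
  rfl

lemma ncard_stackedSketch {R₁ R₂ n : ℕ} {s : ℝ} (hs : s ≠ 0)
    (ω : ((Fin n → Fin R₁) × (Fin n → ℝ)) × ((Fin n → Fin R₂) × (Fin n → ℝ)))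
    (h1 : ∀ i, ω.1.2 i ≠ 0) (h2 : ∀ i, ω.2.2 i ≠ 0) (j : Fin n) :
    {i | stackedSketch s ω i j ≠ 0}.ncard = 2 := by
  have : {i | stackedSketch s ω i j ≠ 0} = {Sum.inl (ω.1.1 j), Sum.inr (ω.2.1 j)} := by
    ext i
    rcases i with i | i
    · simp [stackedSketch, hashMatrix, Matrix.mul_diagonal, hs, h1, eq_comm]
    · simp [stackedSketch, hashMatrix, Matrix.mul_diagonal, h2, eq_comm (a := i)]
  rw [this, Set.ncard_pair (by simp)]

lemma ae_ncard_eq_two {R₁ R₂ n : ℕ} [NeZero R₁] [NeZero R₂] {s : ℝ} (hs : s ≠ 0) :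
    ∀ᵐ S ∂(stackedSketchLaw s R₁ R₂ n), ∀ j : Fin n, {i | S i j ≠ 0}.ncard = 2 := by
  rw [stackedSketchLaw_eq_map, ae_map_iff (measurable_stackedSketch s).aemeasurable]
  · have hC : ∀ᵐ c ∂(cauchyLaw n), ∀ i, c i ≠ 0 := ae_all_iff.2 fun i =>
      (measurePreserving_eval (fun _ : Fin n => cauchyMeasure 0 1) i).quasiMeasurePreserving.ae
        cauchyMeasure_ae_ne_zero
    filter_upwards [Measure.quasiMeasurePreserving_fst.ae
        (Measure.quasiMeasurePreserving_snd.ae (signLaw_ae n)),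
      Measure.quasiMeasurePreserving_snd.ae (Measure.quasiMeasurePreserving_snd.ae hC)]
      with ω h1 h2
    exact ncard_stackedSketch hs ω (fun i => by rcases h1 i with h | h <;> simp [h]) h2
  -- The property has to be measurable to be transferred to the image measure.
  · have hmeas : ∀ j : Fin n, Measurable fun S : Matrix (Fin R₁ ⊕ Fin R₂) (Fin n) ℝ =>
        {i | S i j ≠ 0}.ncard := by
      intro j
      have : ∀ S : Matrix (Fin R₁ ⊕ Fin R₂) (Fin n) ℝ,
          {i | S i j ≠ 0}.ncard = ∑ i, if S i j = 0 then 0 else 1 := by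
        intro S
        classical
        rw [Set.ncard_eq_toFinset_card', Set.toFinset_ofPred, Finset.card_filter]
        exact Finset.sum_congr rfl fun i _ => by by_cases h : S i j = 0 <;> simp [h]
      simp_rw [this]
      refine Finset.measurable_sum _ fun i _ => Measurable.ite ?_ measurable_const measurable_const
      exact (measurableSet_singleton (0 : ℝ)).preimage
        (measurable_entry i j)
    simp only [Set.ofPred_forall]
    exact MeasurableSet.iInter fun j => (hmeas j) (measurableSet_singleton 2)

lemma l1Norm_fromRows_mulVec {R₁ R₂ n : ℕ} {s : ℝ} (hs : 0 ≤ s) (S₁ : Matrix (Fin R₁) (Fin n) ℝ)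
    (S₂ : Matrix (Fin R₂) (Fin n) ℝ) (y : Fin n → ℝ) :
    l1Norm ((Matrix.fromRows (s • S₁) S₂).mulVec y)
      = s * l1Norm (S₁.mulVec y) + l1Norm (S₂.mulVec y) := by
  rw [Matrix.fromRows_mulVec, l1Norm, Fintype.sum_sum_type]
  simp only [Sum.elim_inl, Sum.elim_inr]
  rw [Matrix.smul_mulVec, ← abs_of_nonneg hs, ← l1Norm_smul, abs_of_nonneg hs]
  rfl

/-- A CountSketch does not expand the `ℓ₁`-norm. -/
lemma l1Norm_countSketch_le {R n : ℕ} (h : Fin n → Fin R) {σ : Fin n → ℝ}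
    (hσ : ∀ i, σ i = 1 ∨ σ i = -1) (y : Fin n → ℝ) : l1Norm (hashSketch h σ y) ≤ l1Norm y := by
  have h1 : ∀ i, |σ i| = 1 := fun i => by rcases hσ i with h | h <;> simp [h]
  simp_rw [l1Norm, hashSketch_apply]
  calc ∑ t, |∑ i, σ i * (if h i = t then y i else 0)|
      ≤ ∑ t, ∑ i, (if h i = t then |y i| else 0) := by
        refine Finset.sum_le_sum fun t _ => (Finset.abs_sum_le_sum_abs _ _).trans
          (Finset.sum_le_sum fun i _ => ?_)
        rw [abs_mul, h1, one_mul, apply_ite abs, abs_zero]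
    _ = ∑ i, |y i| := by
        rw [Finset.sum_comm]; simp

/-- The embedding bounds for a well-conditioned matrix `U`, with the two constants `2⁻⁸` and
`1 + 2¹⁶`. -/
lemma stackedSketch_prob {n k d : ℕ} (hd : 2 ≤ d) (hk : k ≤ d) [NeZero (rows d)]
    {U : Matrix (Fin n) (Fin k) ℝ} (hU : IsWellConditioned d 1 U) :
    0.99 ≤ (stackedSketchLaw (d * Real.log d) (rows d) (rows d) n).real
      {S | ∀ x : Fin k → ℝ,
        (2 ^ 8)⁻¹ * Real.log d * l1Norm (U.mulVec x) ≤ l1Norm (S.mulVec (U.mulVec x)) ∧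
        l1Norm (S.mulVec (U.mulVec x))
          ≤ (1 + 2 ^ 16) * (d * Real.log d) * l1Norm (U.mulVec x)} := by
  have hd' : (2 : ℝ) ≤ d := by exact_mod_cast hd
  have hk' : (k : ℝ) ≤ d := by exact_mod_cast hk
  have hs : 0 ≤ d * Real.log d := mul_nonneg (by linarith) (Real.log_nonneg (by linarith))
  set E := {S : Matrix (Fin (rows d) ⊕ Fin (rows d)) (Fin n) ℝ | ∀ x : Fin k → ℝ,
        (2 ^ 8)⁻¹ * Real.log d * l1Norm (U.mulVec x) ≤ l1Norm (S.mulVec (U.mulVec x)) ∧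
        l1Norm (S.mulVec (U.mulVec x))
          ≤ (1 + 2 ^ 16) * (d * Real.log d) * l1Norm (U.mulVec x)}
  set P := sourceLaw (rows d) (rows d) n with hP
  rw [stackedSketchLaw_eq_map]
  have hmap : P.real (stackedSketch (d * Real.log d) ⁻¹' E)
      ≤ (P.map (stackedSketch (d * Real.log d))).real E := by
    have : IsProbabilityMeasure (P.map (stackedSketch (d * Real.log d))) :=
      Measure.isProbabilityMeasure_map (measurable_stackedSketch _).aemeasurable
    exact ENNReal.toReal_mono (measure_ne_top _ _)
      (Measure.le_map_apply (measurable_stackedSketch _).aemeasurable E)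
  refine le_trans ?_ hmap
  set B₀ : Set (Fin n → ℝ) := {σ | ¬ ∀ i, σ i = 1 ∨ σ i = -1} with hB₀
  set B₁ : Set ((Fin n → Fin (rows d)) × (Fin n → ℝ)) :=
    {ω | ∃ x : Fin k → ℝ, 4 * l1Norm (hashSketch ω.1 ω.2 (U.mulVec x)) ^ 2
      < ∑ i, U.mulVec x i ^ 2} with hB₁
  set B₂ : Set ((Fin n → Fin (rows d)) × (Fin n → ℝ)) :=
    {ω | 2 ^ 16 * (d * Real.log d) < entryL1Norm (hashMatrix ω.1 * Matrix.diagonal ω.2 * U)}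
    with hB₂
  set B₃ : Set ((Fin n → Fin (rows d)) × (Fin n → ℝ)) :=
    {ω | ∃ g : Fin k → Fin (2 * (2 ^ 23 * d) + 1),
      1 / 4 ≤ ∑ i, min |U.mulVec (gridPoint (2 ^ 23 * d) g) i| (2 ^ 12 * (d : ℝ) ^ 2)⁻¹ ∧
      l1Norm (hashSketch ω.1 ω.2 (U.mulVec (gridPoint (2 ^ 23 * d) g))) < Real.log d / 64}
    with hB₃
  have hcover : Set.univ ⊆ stackedSketch (d * Real.log d) ⁻¹' E
      ∪ (((Set.univ ×ˢ B₀ ∪ B₁) ×ˢ Set.univ) ∪ Set.univ ×ˢ (B₂ ∪ B₃)) := by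
    intro ω _
    by_contra hω
    simp only [Set.mem_union, Set.mem_prod, Set.mem_univ, true_and, and_true, not_or] at hω
    obtain ⟨hE, ⟨h0, h1⟩, h2, h3⟩ := hω
    simp only [hB₀, hB₁, hB₂, hB₃, Set.mem_ofPred_eq, not_not, not_exists, not_lt, not_and]
      at h0 h1 h2 h3
    refine hE fun x => ?_
    rw [stackedSketch, l1Norm_fromRows_mulVec hs]
    exact bounds_of_good hd hU.1 (fun x => by simpa using hU.2 x) _ _
      (l1Norm_countSketch_le _ h0) h1 h2 h3 x
  have p0 : ((hashLaw (rows d) n).prod (signLaw n)).real (Set.univ ×ˢ B₀) = 0 := by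
    rw [measureReal_prod_prod]
    have : signLaw n B₀ = 0 := signLaw_ae n
    simp [measureReal_def, this]
  have p1 : ((hashLaw (rows d) n).prod (signLaw n)).real B₁ ≤ (2 ^ 10)⁻¹ := by
    refine (countSketch_lower U).trans ?_
    calc 4 * (k : ℝ) ^ 2 * ((rows d : ℕ) : ℝ)⁻¹ ≤ 4 * (d : ℝ) ^ 2 * ((rows d : ℕ) : ℝ)⁻¹ := by
          gcongr
      _ = (2 ^ 10)⁻¹ := by push_cast [rows]; field_simp; norm_num
  have p2 := cauchy_upper_prob hd hk hU.1
  have p3 := cauchy_grid_prob hd hk U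
  have p4 : P.real ((Set.univ ×ˢ B₀ ∪ B₁) ×ˢ Set.univ) ≤ 0 + (2 ^ 10)⁻¹ := by
    rw [hP, measureReal_prod_prod, probReal_univ, mul_one]
    exact (measureReal_union_le _ _).trans (add_le_add p0.le p1)
  have p5 : P.real (Set.univ ×ˢ (B₂ ∪ B₃)) ≤ 2 * (2 ^ 10)⁻¹ + (2 ^ 10)⁻¹ := by
    rw [hP, measureReal_prod_prod, probReal_univ, one_mul]
    exact (measureReal_union_le _ _).trans (add_le_add p2 p3)
  have p6 := measureReal_mono (μ := P) hcover
  rw [probReal_univ] at p6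
  have p7 := p6.trans ((measureReal_union_le _ _).trans
    (add_le_add_right (measureReal_union_le _ _) _))
  have h10 : ((2 : ℝ) ^ 10)⁻¹ ≤ 0.001 := by norm_num
  linarith

end SparseEmbedding

end

open SparseEmbedding in
theorem mainTheorem2 :
    ∃ c C K : ℝ, 0 < c ∧ 0 < C ∧ 0 < K ∧
      ∀ d : ℕ, 2 ≤ d → ∃ R₁ R₂ : ℕ, ((R₁ + R₂ : ℕ) : ℝ) ≤ K * (d : ℝ) ^ 2 ∧
        ∀ n : ℕ, ∃ μ : Measure (Matrix (Fin R₁ ⊕ Fin R₂) (Fin n) ℝ),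
          μ = SparseEmbedding.stackedSketchLaw ((d : ℝ) * Real.log d) R₁ R₂ n ∧
          IsProbabilityMeasure μ ∧
          (∀ᵐ S ∂μ, ∀ j : Fin n, {i | S i j ≠ 0}.ncard = 2) ∧
          (∀ (A : Matrix (Fin n) (Fin d) ℝ) (k : ℕ) (U : Matrix (Fin n) (Fin k) ℝ),
            SparseEmbedding.IsBasisMatrix U A →
            SparseEmbedding.IsWellConditioned (d : ℝ) 1 U →
            0.99 ≤ μ.real {S | ∀ x : Fin k → ℝ,
              c * Real.log d * SparseEmbedding.l1Norm (U.mulVec x)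
                  ≤ SparseEmbedding.l1Norm (S.mulVec (U.mulVec x)) ∧
                SparseEmbedding.l1Norm (S.mulVec (U.mulVec x))
                  ≤ C * ((d : ℝ) * Real.log d) * SparseEmbedding.l1Norm (U.mulVec x)}) ∧
          SparseEmbedding.IsL1ObliviousSubspaceEmbedding d (C / c * d)
            (μ.map fun S => (c * Real.log d)⁻¹ • S) := by
  refine ⟨(2 ^ 8)⁻¹, 1 + 2 ^ 16, 2 ^ 13, by positivity, by positivity, by positivity,
    fun d hd => ⟨rows d, rows d, le_of_eq (by push_cast [rows]; ring), fun n => ⟨_, rfl, ?_⟩⟩⟩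
  have hd' : (2 : ℝ) ≤ d := by exact_mod_cast hd
  have hlog : 0 < Real.log d := Real.log_pos (by linarith)
  have : NeZero (rows d) := ⟨by positivity⟩
  have hprob : IsProbabilityMeasure
      (stackedSketchLaw ((d : ℝ) * Real.log d) (rows d) (rows d) n) := by
    rw [stackedSketchLaw_eq_map]
    exact Measure.isProbabilityMeasure_map (measurable_stackedSketch _).aemeasurable
  have hemb : ∀ (A : Matrix (Fin n) (Fin d) ℝ) (k : ℕ) (U : Matrix (Fin n) (Fin k) ℝ),
      IsBasisMatrix U A → IsWellConditioned (d : ℝ) 1 U → _ :=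
    fun A k U hA hU => stackedSketch_prob hd hA.le hU
  refine ⟨hprob, ae_ncard_eq_two (by positivity), hemb, ?_⟩
  have hmeas : Measurable fun S : Matrix (Fin (rows d) ⊕ Fin (rows d)) (Fin n) ℝ =>
      ((2 ^ 8)⁻¹ * Real.log d)⁻¹ • S := by
    refine measurable_pi_iff.2 fun t => measurable_pi_iff.2 fun i => ?_
    exact (measurable_entry t i).const_mul _
  have hprob' := Measure.isProbabilityMeasure_map
    (μ := stackedSketchLaw ((d : ℝ) * Real.log d) (rows d) (rows d) n) hmeas.aemeasurable
  refine ⟨hprob', fun A => ?_⟩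
  obtain ⟨k, U, hUA, hU⟩ := exists_wellConditioned_basisMatrix A
  refine (hemb A k U hUA hU).trans (le_trans ?_ (ENNReal.toReal_mono (measure_ne_top _ _)
    (Measure.le_map_apply hmeas.aemeasurable _)))
  refine measureReal_mono fun S hS x => ?_
  obtain ⟨z, hz⟩ := hUA.exists_mulVec_eq x
  obtain ⟨h1, h2⟩ := hS z
  rw [hz, Matrix.smul_mulVec, l1Norm_smul, abs_of_pos (by positivity)]
  constructor
  · rw [← div_eq_inv_mul, le_div_iff₀ (by positivity)]
    linarith
  · rw [← div_eq_inv_mul, div_le_iff₀ (by positivity)]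
    refine h2.trans (le_of_eq ?_)
    field_simp
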